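/- **Conventions.** A category $\mathcal K$ is locally small, with possibly a proper class of objects. "Directed colimit" means colimit indexed by a small non-empty directed poset. $\mathbf{Acc}$ is the 2-category of accessible categories, accessible functors and all natural transformations. An object of $\mathbf{Acc}_3^*$ is a pair $(\mathcal K,U)$, where $\mathcal K$ is an accessible category with directed colimits and $U:\mathcal K\to\mathbf{Set}$ is a faithful functor preserving directed colimits, such that: * (coherence) if $U(g)\circ f=U(h)$ with $h:A\to C$, $g:B\to C$ in $\mathcal K$ and $f:UA\to UB$ a map, then $f=U(\bar f)$ for some $\bar f:A\to B$ in $\mathcal K$; * (concrete monomorphisms) every morphism of $\mathcal K$ is a monomorphism and its image under $U$ is injective; * let $\Sigma_{\mathcal K}$ be the relational signature whose $n$-ary symbols ($n$ finite) are the subfunctors $R\subseteq U^n$ such that for every $f:A\to B$ in $\mathcal K$ and $a\in (UA)^n$, $(Uf)^n(a)\in R_B$ implies $a\in R_A$; let $\mathbf{Emb}(\Sigma_{\mathcal K})$ be the category of $\Sigma_{\mathcal K}$-structures and embeddings, and $E:\mathcal K\to\mathbf{Emb}(\Sigma_{\mathcal K})$ the canonical functor. Then $E$ is full with respect to isomorphisms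 (each isomorphism $EA\cong EB$ is $E\bar f$ for an isomorphism $\bar f:A\cong B$) and replete (if $EA\cong X$, there is $B\cong A$ with $EB=X$). These are the categories (concretely equivalent to) abstract elementary classes. A morphism $(\mathcal K_1,U_1)\to(\mathcal K_2,U_2)$ is a functor $F:\mathcal K_1\to\mathcal K_2$ preserving directed colimits which is concrete, i.e. $U_2F=U_1$. The 2-cells are all natural transformations. For functors $F,G:\mathcal K\to\mathcal L$, the category $\mathrm{Ins}(F,G)$ has as objects the pairs $(K,f:FK\to GK)$ and as morphisms $(K,f)\to(K',f')$ the $k:K\to K'$ with $G(k)f=f'F(k)$. For $\varphi,\psi:F\to G$, $\mathrm{Eq}(\varphi,\psi)$ is the full subcategory of $\mathcal K$ on the $K$ with $\varphi_K=\psi_K$. In both cases $P$ denotes the projection to $\mathcal K$. **Theorem 3.3.** $\mathbf{Acc}_3^*$ has PIE-limits, that is, it has small products (in its underlying category), inserters and equifiers (2-categorical, with their one- and two-dimensional strict universal properties). More precisely: 1. *Inserters.* $\mathbf{Acc}_3^*$ is closed in $\mathbf{Acc}$ under inserters: for morphisms $F,G:(\mathcal K,U)\to(\mathcal L,V)$ of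 $\mathbf{Acc}_3^*$, $(\mathrm{Ins}(F,G),UP)$ is an object of $\mathbf{Acc}_3^*$, $P$ is a morphism of $\mathbf{Acc}_3^*$, and $P$ with the canonical $FP\to GP$ is an inserter of $F,G$ both in $\mathbf{Acc}_3^*$ and in $\mathbf{Acc}$. 2. *Equifiers.* $\mathbf{Acc}_3^*$ is closed in $\mathbf{Acc}$ under equifiers: for 2-cells $\varphi,\psi:F\to G$, $(\mathrm{Eq}(\varphi,\psi),UP)$ is an object of $\mathbf{Acc}_3^*$, $P$ is a morphism of $\mathbf{Acc}_3^*$, and $P$ is an equifier of $\varphi,\psi$ both in $\mathbf{Acc}_3^*$ and in $\mathbf{Acc}$. 3. *Products.* Let $(\mathcal K_i,U_i)_{i\in I}$ be a small non-empty family of objects of $\mathbf{Acc}_3^*$, and let $\mathcal P$ be the strict multiple pullback of the $U_i$ over $\mathbf{Set}$ (objects: sets $X$ with objects $A_i$ such that $U_iA_i=X$ for all $i$; morphisms: maps $f$ with morphisms $f_i$ such that $U_if_i=f$ for all $i$), with its functor $U:\mathcal P\to\mathbf{Set}$ and projections $\pi_i$. Then $(\mathcal P,U)$ is an object and the $\pi_i$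 are morphisms of $\mathbf{Acc}_3^*$; they form a product of the $(\mathcal K_i,U_i)$ in the underlying category of $\mathbf{Acc}_3^*$, and a multiple pullback of the $U_i$ over $\mathbf{Set}$ in the underlying category of $\mathbf{Acc}$ (a product in $\mathbf{Acc}\downarrow\mathbf{Set}$). Moreover, for morphisms $H_1,H_2:(\mathcal T,W)\to(\mathcal P,U)$, every family of natural transformations $\theta_i:\pi_iH_1\to\pi_iH_2$ all having the same underlying transformation $W\to W$ is $(\pi_i\theta)_i$ for a unique $\theta:H_1\to H_2$. 4. *Pseudopullbacks.* For every small family of objects of $\mathbf{Acc}_3^*$, the comparison functor from the strict multiple pullback of the $U_i$ over $\mathbf{Set}$ to their multiple pseudopullback (objects: sets $X$ with objects $A_i$ and bijections $U_iA_i\cong X$; morphisms: compatible families) is an equivalence of categories. 5. *Transportability.* For every object $(\mathcal K,U)$ of $\mathbf{Acc}_3^*$, every object $A$ and every bijection $f:UA\to X$ there are $B$ with $UB=X$ and an isomorphism $\bar f:A\to B$ with $U\bar f=f$. If moreover $E$ is injective on objects (i.e. $\mathcal K$ is a class of structures), then the pair $(B,\bar f)$ is unique. -/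

import Mathlib

open CategoryTheory CategoryTheory.Limits

universe w v u w'

namespace AECLimits

/-! ### Directed colimits, concrete categories -/

section Concrete

/-- `K` has colimits of all diagrams indexed by (small, non-empty) directed posets. -/
def HasDirectedColimits (K : Type u) [Category.{v} K] : Prop :=
  ∀ (J : Type w) [PartialOrder J] [IsDirectedOrder J] [Nonempty J], HasColimitsOfShape J K

/-- `F` preserves colimits of diagrams indexed by (small, non-empty) directed posets. -/
def PreservesDirectedColimits {K L : Type (w + 1)} [Category.{w} K] [Category.{w} L]
    (F : K ⥤ L) : Prop :=
  ∀ (J : Type w) [PartialOrder J] [IsDirectedOrder J] [Nonempty J], PreservesColimitsOfShape J F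

variable {K : Type (w + 1)} [Category.{w} K] (U : K ⥤ Type w)

/-- `(K, U)` is an accessible category with concrete directed colimits. -/
structure IsAccessibleWithConcreteDirectedColimits : Prop where
  accessible : IsAccessibleCategory.{w} K
  hasDirectedColimits : HasDirectedColimits.{w} K
  faithful : U.Faithful
  preservesDirectedColimits : PreservesDirectedColimits U

/-- Coherence: if `U h = U g ∘ f` with `h : A ⟶ C`, `g : B ⟶ C` in `K` and `f : U A → U B` a map of
sets, then `f` underlies a morphism `A ⟶ B`. -/
def IsCoherent : Prop :=
  ∀ ⦃A B C : K⦄ (h : A ⟶ C) (g : B ⟶ C) (f : U.obj A ⟶ U.obj B),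
    f ≫ U.map g = U.map h → ∃ f' : A ⟶ B, U.map f' = f

/-- Every morphism of `K` is a monomorphism, and it is preserved by `U`. -/
structure HasConcreteMonos : Prop where
  mono : ∀ ⦃A B : K⦄ (f : A ⟶ B), Mono f
  mono_map : ∀ ⦃A B : K⦄ (f : A ⟶ B), Mono (U.map f)

/-- An `n`-ary relation symbol interpretable in `(K, U)` (a subfunctor of `U ^ n`)
for which the morphisms of `K` behave as embeddings. -/
structure InterpretableRelation (n : ℕ) where
  rel : ∀ A : K, Set (Fin n → U.obj A)
  map_mem : ∀ ⦃A B : K⦄ (f : A ⟶ B) (a : Fin n → U.obj A),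
    a ∈ rel A → (fun i => U.map f (a i)) ∈ rel B
  mem_of_map_mem : ∀ ⦃A B : K⦄ (f : A ⟶ B) (a : Fin n → U.obj A),
    (fun i => U.map f (a i)) ∈ rel B → a ∈ rel A

/-- The relational signature consisting of all `InterpretableRelation`s. -/
def signature : FirstOrder.Language.{0, w + 1} where
  Functions _ := PEmpty
  Relations n := InterpretableRelation U n

end Concrete

/-- Structures (with carrier in `Type w`) for the signature `S`. -/
structure Emb (S : FirstOrder.Language.{0, v}) where
  carrier : Type w
  str : S.Structure carrier

attribute [instance] Emb.str

/-- The category of `S`-structures and substructure embeddings. -/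
instance (S : FirstOrder.Language.{0, v}) : Category.{w} (Emb.{w} S) where
  Hom M N := S.Embedding M.carrier N.carrier
  id M := FirstOrder.Language.Embedding.refl S M.carrier
  comp f g := FirstOrder.Language.Embedding.comp g f

section Canonical

variable {K : Type (w + 1)} [Category.{w} K] (U : K ⥤ Type w)

/-- The object `U A`, as a structure for `signature U`. -/
def canonicalStructure (A : K) : Emb.{w} (signature U) where
  carrier := U.obj A
  str :=
    { funMap := fun f => PEmpty.elim f
      RelMap := fun R a => a ∈ InterpretableRelation.rel R A }

/-- The canonical functor from `K` to structures and embeddings. -/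
def canonicalFunctor (hU : HasConcreteMonos U) : K ⥤ Emb.{w} (signature U) where
  obj A := canonicalStructure U A
  map {A B} f :=
    show (signature U).Embedding (canonicalStructure U A).carrier
        (canonicalStructure U B).carrier from
    { toFun := fun a => U.map f a
      inj' := (mono_iff_injective _).1 (hU.mono_map f)
      map_fun' := fun g _ => PEmpty.elim g
      map_rel' := fun R a =>
        ⟨InterpretableRelation.mem_of_map_mem R f a, InterpretableRelation.map_mem R f a⟩ }
  map_id A := by
    apply FirstOrder.Language.Embedding.ext
    intro a
    change U.map (𝟙 A) a = a
    rw [U.map_id]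
    rfl
  map_comp {A B C} f g := by
    apply FirstOrder.Language.Embedding.ext
    intro a
    change U.map (f ≫ g) a = U.map g (U.map f a)
    rw [U.map_comp]
    rfl

/-- `E` is full with respect to isomorphisms. -/
def IsFullOnIsos {C : Type*} {D : Type*} [Category* C] [Category* D] (E : C ⥤ D) : Prop :=
  ∀ ⦃A B : C⦄ (f : E.obj A ≅ E.obj B), ∃ g : A ≅ B, E.mapIso g = f

/-- `E` is replete. -/
def IsReplete {C : Type*} {D : Type*} [Category* C] [Category* D] (E : C ⥤ D) : Prop :=
  ∀ ⦃A : C⦄ ⦃X : D⦄, Nonempty (E.obj A ≅ X) → ∃ B : C, Nonempty (A ≅ B) ∧ E.obj B = X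

/-- `(K, U)` is an abstract elementary class, in the syntax-free sense: the canonical functor to
structures and embeddings is full with respect to isomorphisms and replete. This functor need not be
injective on objects, so `K` is a class of structures only up to a concrete equivalence. -/
structure IsAEC : Prop where
  concreteDirectedColimits : IsAccessibleWithConcreteDirectedColimits U
  coherent : IsCoherent U
  concreteMonos : HasConcreteMonos U
  isoFull : IsFullOnIsos (canonicalFunctor U concreteMonos)
  replete : IsReplete (canonicalFunctor U concreteMonos)

variable {U} in
/-- `p` is an isomorphism `A ≅ B` in `K` with `U B = X` whose underlying bijection is `f`. -/
def IsLiftOfIso {A : K} {X : Type w} (f : U.obj A ≅ X) (p : Σ B : K, A ≅ B) : Prop :=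
  ∃ h : U.obj p.1 = X, U.map p.2.hom ≫ eqToHom h = f.hom

/-- Every bijection `U A ≅ X` lifts to an isomorphism of `K` with domain `A`. -/
def LiftsIsos : Prop :=
  ∀ ⦃A : K⦄ ⦃X : Type w⦄ (f : U.obj A ≅ X), ∃ p : Σ B : K, A ≅ B, IsLiftOfIso f p

/-- Every bijection `U A ≅ X` lifts to a unique isomorphism of `K` with domain `A`. -/
def IsTransportable : Prop :=
  ∀ ⦃A : K⦄ ⦃X : Type w⦄ (f : U.obj A ≅ X), ∃! p : Σ B : K, A ≅ B, IsLiftOfIso f p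

end Canonical

/-! ### The 2-category of accessible categories -/

/-- Accessible categories. -/
structure Acc where
  carrier : Type (w + 1)
  [cat : Category.{w} carrier]
  accessible : IsAccessibleCategory.{w} carrier

attribute [instance] Acc.cat

namespace Acc

/-- Accessible functors. -/
@[ext]
structure Hom (K L : Acc.{w}) where
  functor : K.carrier ⥤ L.carrier
  accessible : functor.IsAccessible.{w}

instance : CategoryStruct Acc.{w} where
  Hom K L := Hom K L
  id K :=
    { functor := 𝟭 K.carrier
      accessible := by
        have : Fact Cardinal.aleph0.IsRegular := Cardinal.fact_isRegular_aleph0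
        exact Functor.isAccessible_of_isCardinalAccessible _ Cardinal.aleph0 }
  comp F G :=
    { functor := F.functor ⋙ G.functor
      accessible := by
        have := F.accessible
        have := G.accessible
        infer_instance }

@[simp] lemma id_functor (K : Acc.{w}) : Hom.functor (𝟙 K) = 𝟭 K.carrier := rfl

@[simp] lemma comp_functor {K L M : Acc.{w}} (F : K ⟶ L) (G : L ⟶ M) :
    Hom.functor (F ≫ G) = Hom.functor F ⋙ Hom.functor G := rfl

/-- The 2-cells are all natural transformations. -/
@[ext]
structure Hom₂ {K L : Acc.{w}} (F G : K ⟶ L) where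
  trans : Hom.functor F ⟶ Hom.functor G

instance (K L : Acc.{w}) : Category (K ⟶ L) where
  Hom F G := Hom₂ F G
  id F := ⟨𝟙 (Hom.functor F)⟩
  comp α β := ⟨α.trans ≫ β.trans⟩

@[ext] lemma hom₂_ext {K L : Acc.{w}} {F G : K ⟶ L} {α β : F ⟶ G}
    (h : α.trans = β.trans) : α = β := Hom₂.ext h

@[simp] lemma id_trans {K L : Acc.{w}} (F : K ⟶ L) :
    Hom₂.trans (𝟙 F) = 𝟙 (Hom.functor F) := rfl

@[simp] lemma comp_trans {K L : Acc.{w}} {F G H : K ⟶ L} (α : F ⟶ G) (β : G ⟶ H) :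
    Hom₂.trans (α ≫ β) = α.trans ≫ β.trans := rfl

/-- The 2-category of accessible categories, accessible functors and natural transformations. -/
instance : Bicategory Acc.{w} where
  homCategory K L := inferInstance
  whiskerLeft F _ _ η := Hom₂.mk (Functor.whiskerLeft (Hom.functor F) η.trans)
  whiskerRight η H := Hom₂.mk (Functor.whiskerRight η.trans (Hom.functor H))
  associator F G H :=
    { hom := Hom₂.mk (Functor.associator F.functor G.functor H.functor).hom
      inv := Hom₂.mk (Functor.associator F.functor G.functor H.functor).inv }
  leftUnitor F :=
    { hom := Hom₂.mk F.functor.leftUnitor.hom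
      inv := Hom₂.mk F.functor.leftUnitor.inv }
  rightUnitor F :=
    { hom := Hom₂.mk F.functor.rightUnitor.hom
      inv := Hom₂.mk F.functor.rightUnitor.inv }

instance : Bicategory.Strict Acc.{w} where
  leftUnitor_eqToIso _ := Iso.ext rfl
  rightUnitor_eqToIso _ := Iso.ext rfl
  associator_eqToIso _ _ _ := Iso.ext rfl

/-- The category of sets. -/
def set : Acc.{w} where
  carrier := Type w
  accessible := inferInstance

end Acc

/-! ### The 2-category of abstract elementary classes and concrete functors -/

lemma PreservesDirectedColimits.comp {K L M : Type (w + 1)} [Category.{w} K] [Category.{w} L]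
    [Category.{w} M] {F : K ⥤ L} {G : L ⥤ M} (hF : PreservesDirectedColimits F)
    (hG : PreservesDirectedColimits G) : PreservesDirectedColimits (F ⋙ G) := by
  intro J _ _ _
  have := hF J
  have := hG J
  infer_instance

lemma PreservesDirectedColimits.isAccessible {K L : Type (w + 1)} [Category.{w} K]
    [Category.{w} L] {F : K ⥤ L} (hF : PreservesDirectedColimits F) :
    F.IsAccessible.{w} := by
  have : Fact Cardinal.aleph0.{w}.IsRegular := Cardinal.fact_isRegular_aleph0
  have : F.IsCardinalAccessible Cardinal.aleph0.{w} :=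
    { preservesColimitOfShape := fun J _ hJ => by
        have : IsFiltered J := (isCardinalFiltered_aleph0_iff.{w} J).1 hJ
        obtain ⟨α, _, _, _, G, _⟩ := IsFiltered.exists_directed J
        have := hF α
        exact Functor.Final.preservesColimitsOfShape_of_final G F }
  exact Functor.isAccessible_of_isCardinalAccessible F Cardinal.aleph0.{w}

/-- Categories (concretely equivalent to) abstract elementary classes, with their underlying set
functor. -/
structure Acc3Star where
  carrier : Type (w + 1)
  [cat : Category.{w} carrier]
  U : carrier ⥤ Type w
  isAEC : IsAEC U

attribute [instance] Acc3Star.cat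

namespace Acc3Star

/-- Concrete functors preserving directed colimits. -/
@[ext]
structure Hom (K L : Acc3Star.{w}) where
  functor : K.carrier ⥤ L.carrier
  concrete : functor ⋙ L.U = K.U
  preservesDirectedColimits : PreservesDirectedColimits functor

instance : CategoryStruct Acc3Star.{w} where
  Hom K L := Hom K L
  id K :=
    { functor := 𝟭 K.carrier
      concrete := rfl
      preservesDirectedColimits := fun _ _ _ _ => inferInstance }
  comp F G :=
    { functor := F.functor ⋙ G.functor
      concrete := by rw [Functor.assoc, G.concrete, F.concrete]
      preservesDirectedColimits :=
        F.preservesDirectedColimits.comp G.preservesDirectedColimits }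

@[simp] lemma id_functor (K : Acc3Star.{w}) : Hom.functor (𝟙 K) = 𝟭 K.carrier := rfl

@[simp] lemma comp_functor {K L M : Acc3Star.{w}} (F : K ⟶ L) (G : L ⟶ M) :
    Hom.functor (F ≫ G) = Hom.functor F ⋙ Hom.functor G := rfl

/-- The 2-cells are all natural transformations. -/
@[ext]
structure Hom₂ {K L : Acc3Star.{w}} (F G : K ⟶ L) where
  trans : Hom.functor F ⟶ Hom.functor G

instance (K L : Acc3Star.{w}) : Category (K ⟶ L) where
  Hom F G := Hom₂ F G
  id F := ⟨𝟙 (Hom.functor F)⟩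
  comp α β := ⟨α.trans ≫ β.trans⟩

@[ext] lemma hom₂_ext {K L : Acc3Star.{w}} {F G : K ⟶ L} {α β : F ⟶ G}
    (h : α.trans = β.trans) : α = β := Hom₂.ext h

@[simp] lemma id_trans {K L : Acc3Star.{w}} (F : K ⟶ L) :
    Hom₂.trans (𝟙 F) = 𝟙 (Hom.functor F) := rfl

@[simp] lemma comp_trans {K L : Acc3Star.{w}} {F G H : K ⟶ L} (α : F ⟶ G) (β : G ⟶ H) :
    Hom₂.trans (α ≫ β) = α.trans ≫ β.trans := rfl

/-- The 2-category of abstract elementary classes, concrete functors preserving directed colimits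
and natural transformations. -/
instance : Bicategory Acc3Star.{w} where
  homCategory K L := inferInstance
  whiskerLeft F _ _ η := Hom₂.mk (Functor.whiskerLeft (Hom.functor F) η.trans)
  whiskerRight η H := Hom₂.mk (Functor.whiskerRight η.trans (Hom.functor H))
  associator F G H :=
    { hom := Hom₂.mk (Functor.associator F.functor G.functor H.functor).hom
      inv := Hom₂.mk (Functor.associator F.functor G.functor H.functor).inv }
  leftUnitor F :=
    { hom := Hom₂.mk F.functor.leftUnitor.hom
      inv := Hom₂.mk F.functor.leftUnitor.inv }
  rightUnitor F :=
    { hom := Hom₂.mk F.functor.rightUnitor.hom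
      inv := Hom₂.mk F.functor.rightUnitor.inv }

instance : Bicategory.Strict Acc3Star.{w} where
  leftUnitor_eqToIso _ := Iso.ext rfl
  rightUnitor_eqToIso _ := Iso.ext rfl
  associator_eqToIso _ _ _ := Iso.ext rfl

/-- The underlying accessible category. -/
def toAcc (K : Acc3Star.{w}) : Acc.{w} where
  carrier := K.carrier
  accessible := K.isAEC.concreteDirectedColimits.accessible

/-- The underlying accessible functor. -/
def Hom.toAcc {K L : Acc3Star.{w}} (F : K ⟶ L) : K.toAcc ⟶ L.toAcc :=
  Acc.Hom.mk (Hom.functor F) (Hom.preservesDirectedColimits F).isAccessible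

/-- The underlying natural transformation, as a 2-cell of accessible categories. -/
def Hom₂.toAcc {K L : Acc3Star.{w}} {F G : K ⟶ L} (α : F ⟶ G) : Hom.toAcc F ⟶ Hom.toAcc G :=
  Acc.Hom₂.mk (Hom₂.trans α)

/-- The underlying set functor, as an accessible functor. -/
def forget (K : Acc3Star.{w}) : K.toAcc ⟶ Acc.set.{w} :=
  Acc.Hom.mk K.U K.isAEC.concreteDirectedColimits.preservesDirectedColimits.isAccessible

lemma Hom.toAcc_comp_forget {K L : Acc3Star.{w}} (F : K ⟶ L) :
    Hom.toAcc F ≫ L.forget = K.forget :=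
  Acc.Hom.ext (Hom.concrete F)

/-- `θ : F ⟶ G` lies over `τ`, that is, its underlying transformation of set functors is `τ`. -/
def LiesOver {K L : Acc3Star.{w}} {F G : K ⟶ L} (θ : F ⟶ G) (τ : K.U ⟶ K.U) : Prop :=
  Functor.whiskerRight (Hom₂.trans θ) L.U =
    eqToHom (Hom.concrete F) ≫ τ ≫ eqToHom (Hom.concrete G).symm

end Acc3Star

/-! ### Products, inserters and equifiers in a 2-category -/

section TwoLimits

open Bicategory

variable {B : Type u} [Bicategory.{w', v} B] [Bicategory.Strict B]

/-- Whiskering `φ : P ≫ F ⟶ P ≫ G` with `H`. -/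
def whiskered {T I K L : B} {F G : K ⟶ L} {P : I ⟶ K} (φ : P ≫ F ⟶ P ≫ G) (H : T ⟶ I) :
    (H ≫ P) ≫ F ⟶ (H ≫ P) ≫ G :=
  (α_ H P F).hom ≫ H ◁ φ ≫ (α_ H P G).inv

/-- `P : I ⟶ K` with `φ : P ≫ F ⟶ P ≫ G` is an inserter of `F` and `G`
(one- and two-dimensional universal property). -/
structure IsInserter {I K L : B} (F G : K ⟶ L) (P : I ⟶ K) (φ : P ≫ F ⟶ P ≫ G) : Prop where
  existsUnique_lift : ∀ {T : B} (H : T ⟶ K) (ψ : H ≫ F ⟶ H ≫ G),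
    ∃! H' : T ⟶ I, ∃ h : H' ≫ P = H,
      whiskered φ H' = eqToHom (by rw [h]) ≫ ψ ≫ eqToHom (by rw [h])
  existsUnique_lift₂ : ∀ {T : B} (H₁ H₂ : T ⟶ I) (θ : H₁ ≫ P ⟶ H₂ ≫ P),
    whiskered φ H₁ ≫ θ ▷ G = θ ▷ F ≫ whiskered φ H₂ → ∃! θ' : H₁ ⟶ H₂, θ' ▷ P = θ

/-- `P : E ⟶ K` is an equifier of `φ` and `ψ` (one- and two-dimensional universal property). -/
structure IsEquifier {E K L : B} {F G : K ⟶ L} (φ ψ : F ⟶ G) (P : E ⟶ K) : Prop where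
  whisker_eq : P ◁ φ = P ◁ ψ
  existsUnique_lift : ∀ {T : B} (H : T ⟶ K), H ◁ φ = H ◁ ψ → ∃! H' : T ⟶ E, H' ≫ P = H
  existsUnique_lift₂ : ∀ {T : B} (H₁ H₂ : T ⟶ E) (θ : H₁ ≫ P ⟶ H₂ ≫ P),
    ∃! θ' : H₁ ⟶ H₂, θ' ▷ P = θ

end TwoLimits

/-- `B` has `w`-small products (in its underlying category), inserters and equifiers. -/
structure HasPIELimits (B : Type u) [Bicategory.{w', v} B] [Bicategory.Strict B] : Prop where
  hasProducts : ∀ I : Type w, HasLimitsOfShape (Discrete I) B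
  hasInserters : ∀ {K L : B} (F G : K ⟶ L),
    ∃ (I : B) (P : I ⟶ K) (φ : P ≫ F ⟶ P ≫ G), IsInserter F G P φ
  hasEquifiers : ∀ {K L : B} {F G : K ⟶ L} (φ ψ : F ⟶ G),
    ∃ (E : B) (P : E ⟶ K), IsEquifier φ ψ P

/-! ### The limits of categories -/

section Inserter

variable {K L : Type (w + 1)} [Category.{w} K] [Category.{w} L] (F G : K ⥤ L)

/-- Objects of the inserter category `Ins(F, G)`. -/
structure Ins where
  obj : K
  str : F.obj obj ⟶ G.obj obj

namespace Ins

variable {F G}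

/-- Morphisms of `Ins(F, G)`. -/
@[ext]
structure Hom (X Y : Ins F G) where
  hom : X.obj ⟶ Y.obj
  comm : X.str ≫ G.map hom = F.map hom ≫ Y.str

instance : Category.{w} (Ins F G) where
  Hom X Y := Hom X Y
  id X := ⟨𝟙 X.obj, by simp⟩
  comp {X Y Z} f g := ⟨f.hom ≫ g.hom, by
    rw [G.map_comp, F.map_comp, reassoc_of% f.comm, g.comm, Category.assoc]⟩

variable (F G)

/-- The projection functor `Ins(F, G) ⥤ K`. -/
def proj : Ins F G ⥤ K where
  obj X := X.obj
  map f := f.hom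

/-- The universal 2-cell of `Ins(F, G)`. -/
def trans : proj F G ⋙ F ⟶ proj F G ⋙ G where
  app X := X.str
  naturality _ _ f := f.comm.symm

end Ins

variable {F G} in
/-- The equifier category `Eq(φ, ψ)`. -/
abbrev Equif (φ ψ : F ⟶ G) : Type (w + 1) :=
  ObjectProperty.FullSubcategory (fun A : K => φ.app A = ψ.app A)

variable {F G} in
/-- The inclusion functor of `Eq(φ, ψ)`. -/
abbrev Equif.proj (φ ψ : F ⟶ G) : Equif φ ψ ⥤ K :=
  ObjectProperty.ι (fun A : K => φ.app A = ψ.app A)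

end Inserter

section Pullback

variable {I : Type w} {K : I → Type (w + 1)} [∀ i, Category.{w} (K i)]
  (U : ∀ i, K i ⥤ Type w)

/-- Objects of the (strict) multiple pullback of functors `U i` over `Set`. -/
structure MultiPullback where
  base : Type w
  obj : ∀ i, K i
  obj_eq : ∀ i, (U i).obj (obj i) = base

/-- Objects of the multiple pseudopullback of functors `U i` over `Set`. -/
structure MultiPseudoPullback where
  base : Type w
  obj : ∀ i, K i
  iso : ∀ i, (U i).obj (obj i) ≅ base

variable {U}

namespace MultiPseudoPullback

/-- Morphisms of the multiple pseudopullback. -/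
@[ext]
structure Hom (X Y : MultiPseudoPullback U) where
  base : X.base ⟶ Y.base
  app : ∀ i, X.obj i ⟶ Y.obj i
  comm : ∀ i, (U i).map (app i) ≫ (Y.iso i).hom = (X.iso i).hom ≫ base

instance : Category.{w} (MultiPseudoPullback U) where
  Hom X Y := Hom X Y
  id X := ⟨𝟙 X.base, fun i => 𝟙 (X.obj i), fun i => by simp⟩
  comp {X Y Z} f g := ⟨f.base ≫ g.base, fun i => f.app i ≫ g.app i, fun i => by
    rw [Functor.map_comp, Category.assoc, g.comm, reassoc_of% (f.comm i)]⟩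

end MultiPseudoPullback

namespace MultiPullback

/-- Morphisms of the multiple pullback. -/
@[ext]
structure Hom (X Y : MultiPullback U) where
  base : X.base ⟶ Y.base
  app : ∀ i, X.obj i ⟶ Y.obj i
  comm : ∀ i, (U i).map (app i) ≫ eqToHom (Y.obj_eq i) = eqToHom (X.obj_eq i) ≫ base

instance : Category.{w} (MultiPullback U) where
  Hom X Y := Hom X Y
  id X := ⟨𝟙 X.base, fun i => 𝟙 (X.obj i), fun i => by simp⟩
  comp {X Y Z} f g := ⟨f.base ≫ g.base, fun i => f.app i ≫ g.app i, fun i => by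
    rw [Functor.map_comp, Category.assoc, g.comm, reassoc_of% (f.comm i)]⟩

lemma eq_eqToHom_comp_comp {C : Type u} [Category.{v} C] {a b c d : C} (p : a = c) (q : b = d)
    {f : a ⟶ b} {g : c ⟶ d} (h : f ≫ eqToHom q = eqToHom p ≫ g) :
    f = eqToHom p ≫ g ≫ eqToHom q.symm := by
  subst p q
  simpa using h

variable (U)

/-- The projection of the multiple pullback to `Set`. -/
def toSet : MultiPullback U ⥤ Type w where
  obj X := X.base
  map f := f.base

/-- The projections of the multiple pullback. -/
def proj (i : I) : MultiPullback U ⥤ K i where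
  obj X := X.obj i
  map f := f.app i

lemma proj_comp (i : I) : proj U i ⋙ U i = toSet U :=
  CategoryTheory.Functor.ext (fun X => X.obj_eq i) fun X Y f =>
    eq_eqToHom_comp_comp (X.obj_eq i) (Y.obj_eq i) (f.comm i)

/-- The comparison functor from the multiple pullback to the multiple pseudopullback. -/
def toPseudo : MultiPullback U ⥤ MultiPseudoPullback U where
  obj X := ⟨X.base, X.obj, fun i => eqToIso (X.obj_eq i)⟩
  map f := ⟨f.base, f.app, fun i => f.comm i⟩

end MultiPullback

end Pullback

end AECLimits

open AECLimits Bicategory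

/-!
Accessibility is never established through a limit theorem for accessible categories. For a coherent
concrete category `U : K ⥤ Set` with injective morphisms and concrete directed colimits
(`IsCoherentConcrete`), a morphism into `A` is determined up to isomorphism by its image, a *strong*
subset of `U A`; factorizations are inclusions of strong subsets, and directed unions of strong
subsets are strong. Hence accessibility amounts to a downward Löwenheim–Skolem property
(`IsLowenheimSkolem`): every subset of cardinality `< κ` lies in a strong one of cardinality `< κ`,
and the objects of cardinality `< κ` form a set up to isomorphism. An accessible category has this
property for all large regular `κ` (`IsCoherentConcrete.exists_isLowenheimSkolem`), and one regular
`κ` with this property suffices for accessibility (`IsLowenheimSkolem.isAccessibleCategory`). The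
property passes to the limits by closing off:

* An object of the inserter of concrete functors is an object of `K` with a unary operation on its
  underlying set (`Ins.op`). The strong subsets that are closed under this operation are strong in
  the inserter, by coherence of the codomain.
* An equifier is a full subcategory closed under subobjects, as the morphisms of the codomain are
  monomorphisms, and under directed colimits (`IsAEC.ι_comp`).
* In a multiple pullback, a subset which is strong in every component is strong. Such subsets arise
  as unions of an `ω`-chain in which each step closes off in every component
  (`exists_chain_closing_off`), where `κ` exceeds the number of components.

Fullness on isomorphisms holds in the limits since relation symbols pull back along concrete
functors (`IsAEC.exists_iso_of_concrete`): an isomorphism of canonical structures of the limit is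
one for each component. For inserters the graph of the operation is a further binary relation
symbol. Given fullness on isomorphisms, repleteness says that bijections lift along `U`
(`LiftsIsos.isReplete`, `liftsIsos_of_isReplete`), which is transportability. It is also what
allows directed colimits in a multiple pullback to be formed with a common underlying set on the
nose, and what makes the comparison with the multiple pseudopullback essentially surjective.

For the universal properties among accessible categories, the point is that `U` reflects the
colimits in question: a functor to an abstract elementary class is accessible as soon as its
composite with `U` is (`IsCoherentConcrete.isAccessible_of_comp`). The empty product is the category
of sets and injections (`InjSet`).
-/

namespace AECLimits

/-! ### Closing off under countably many steps -/

section Closure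

variable {T : Type w} {κ : Cardinal.{w}} [Fact κ.IsRegular]

/-- Iterating fewer than `κ` closing operations `ω` times, from a set of cardinality `< κ`. The
relation `R i X Z` says that `Z` is closed off from `X` with respect to the `i`-th operation. -/
lemma exists_chain_closing_off (hκ : Cardinal.aleph0 < κ) {ι : Type w} (hι : HasCardinalLT ι κ)
    (R : ι → Set T → Set T → Prop)
    (hR : ∀ i (X : Set T), HasCardinalLT X κ →
      ∃ Z : Set T, X ⊆ Z ∧ HasCardinalLT Z κ ∧ R i X Z)
    (X : Set T) (hX : HasCardinalLT X κ) :
    ∃ Y : ℕ → Set T, X ⊆ Y 0 ∧ Monotone Y ∧ HasCardinalLT (⋃ n, Y n) κ ∧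
      ∀ i n, ∃ Z, Y n ⊆ Z ∧ Z ⊆ Y (n + 1) ∧ R i (Y n) Z := by
  choose! Z hZ₁ hZ₂ hZ₃ using hR
  let Y : ℕ → Set T := fun n => Nat.rec X (fun _ W => W ∪ ⋃ i, Z i W) n
  have hY : ∀ n, Y (n + 1) = Y n ∪ ⋃ i, Z i (Y n) := fun n => rfl
  have hY' : ∀ n, HasCardinalLT ↥(Y n) κ := by
    intro n
    induction n with
    | zero => exact hX
    | succ n ih =>
      rw [hY]
      exact hasCardinalLT_union hκ.le ih
        (hasCardinalLT_iUnion _ hι fun i => hZ₂ i _ ih)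
  refine ⟨Y, subset_rfl, monotone_nat_of_le_succ fun n => ?_, ?_, fun i n => ?_⟩
  · rw [hY]
    exact Set.subset_union_left
  · refine hasCardinalLT_iUnion _ ?_ hY'
    rw [← hasCardinalLT_lift_iff.{w, 0, w}]
    · simpa [HasCardinalLT] using hκ
  · refine ⟨Z i (Y n), hZ₁ i _ (hY' n), ?_, hZ₃ i _ (hY' n)⟩
    rw [hY]
    exact (Set.subset_iUnion (fun i => Z i (Y n)) i).trans Set.subset_union_right

/-- A set of cardinality `< κ` is contained in one which is closed under a binary operation. -/
lemma exists_closed_under_binary (hκ : Cardinal.aleph0 < κ) (m : T → T → T)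
    (X : Set T) (hX : HasCardinalLT X κ) :
    ∃ Y : Set T, X ⊆ Y ∧ HasCardinalLT Y κ ∧ ∀ a ∈ Y, ∀ b ∈ Y, m a b ∈ Y := by
  obtain ⟨Y, h₁, h₂, h₃, h₄⟩ := exists_chain_closing_off hκ (ι := PUnit)
    (hasCardinalLT_of_finite _ _ hκ.le) (fun _ X Z => ∀ a ∈ X, ∀ b ∈ X, m a b ∈ Z)
    (fun _ X hX => ⟨X ∪ Set.image2 m X X, Set.subset_union_left,
      hasCardinalLT_union hκ.le hX (by
        rw [← Set.image_uncurry_prod]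
        refine (hasCardinalLT_prod hκ.le hX hX).of_surjective
          (fun p => ⟨m p.1 p.2, ⟨(p.1, p.2), ⟨p.1.2, p.2.2⟩, rfl⟩⟩) ?_
        rintro ⟨_, ⟨a, b⟩, ⟨ha, hb⟩, rfl⟩
        exact ⟨⟨⟨a, ha⟩, ⟨b, hb⟩⟩, rfl⟩),
      fun a ha b hb => Or.inr ⟨a, ha, b, hb, rfl⟩⟩) X hX
  refine ⟨⋃ n, Y n, h₁.trans (Set.subset_iUnion _ 0), h₃, ?_⟩
  intro a ha b hb
  obtain ⟨i, hi⟩ := Set.mem_iUnion.1 ha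
  obtain ⟨j, hj⟩ := Set.mem_iUnion.1 hb
  obtain ⟨Z, -, hZ, hm⟩ := h₄ ⟨⟩ (max i j)
  exact Set.mem_iUnion.2 ⟨_, hZ (hm a (h₂ (le_max_left i j) hi) b (h₂ (le_max_right i j) hj))⟩

end Closure

/-! ### Strong subsets of the objects of a coherent concrete category -/

section Strong

variable {K : Type (w + 1)} [Category.{w} K]

lemma HasDirectedColimits.hasColimitsOfShape (h : HasDirectedColimits.{w} K)
    (J : Type w) [SmallCategory J] [IsFiltered J] : HasColimitsOfShape J K := by
  obtain ⟨α, _, _, _, G, _⟩ := IsFiltered.exists_directed J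
  have := h α
  exact Functor.Final.hasColimitsOfShape_of_final G

lemma PreservesDirectedColimits.preservesColimitsOfShape {L : Type (w + 1)} [Category.{w} L]
    {F : K ⥤ L} (h : PreservesDirectedColimits F)
    (J : Type w) [SmallCategory J] [IsFiltered J] : PreservesColimitsOfShape J F := by
  obtain ⟨α, _, _, _, G, _⟩ := IsFiltered.exists_directed J
  have := h α
  exact Functor.Final.preservesColimitsOfShape_of_final G F

variable (U : K ⥤ Type w)

/-- A coherent concrete category whose morphisms are injective and which has concrete directed
colimits: the axioms of `IsAEC` except for accessibility and for those on isomorphisms. -/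
structure IsCoherentConcrete : Prop where
  hasDirectedColimits : HasDirectedColimits.{w} K
  faithful : U.Faithful
  preservesDirectedColimits : PreservesDirectedColimits U
  coherent : IsCoherent U
  map_injective : ∀ ⦃A B : K⦄ (f : A ⟶ B), Function.Injective (U.map f)

lemma IsAEC.isCoherentConcrete {U : K ⥤ Type w} (h : IsAEC U) : IsCoherentConcrete U where
  hasDirectedColimits := h.concreteDirectedColimits.hasDirectedColimits
  faithful := h.concreteDirectedColimits.faithful
  preservesDirectedColimits := h.concreteDirectedColimits.preservesDirectedColimits
  coherent := h.coherent
  map_injective _ _ f := (mono_iff_injective _).1 (h.concreteMonos.mono_map f)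

/-- A subset of `U A` is strong if it is the image of a morphism of `K`. -/
def IsStrong {A : K} (X : Set (U.obj A)) : Prop :=
  ∃ (B : K) (g : B ⟶ A), Set.range (U.map g) = X

variable {U}

namespace IsCoherentConcrete

variable (hU : IsCoherentConcrete U)

include hU

lemma hasConcreteMonos : HasConcreteMonos U where
  mono_map _ _ f := (mono_iff_injective _).2 (hU.map_injective f)
  mono A B f := by
    have := hU.faithful
    have : Mono (U.map f) := (mono_iff_injective _).2 (hU.map_injective f)
    exact U.mono_of_mono_map this

lemma mono {A B : K} (f : A ⟶ B) : Mono f := hU.hasConcreteMonos.mono f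

/-- A morphism factors through another one with the same codomain as soon as its image does. -/
lemma exists_lift_of_range_subset {A B C : K} (h : A ⟶ C) (g : B ⟶ C)
    (hr : Set.range (U.map h) ⊆ Set.range (U.map g)) : ∃ f : A ⟶ B, f ≫ g = h := by
  have := hU.faithful
  choose f hf using fun x => hr (Set.mem_range_self x)
  have e : (↾f : U.obj A ⟶ U.obj B) ≫ U.map g = U.map h := by
    ext x
    exact hf x
  obtain ⟨f', hf'⟩ := hU.coherent h g (↾f) e
  exact ⟨f', U.map_injective (by rw [U.map_comp, hf', e])⟩

lemma isIso_of_surjective {A B : K} (f : A ⟶ B) (hf : Function.Surjective (U.map f)) :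
    IsIso f := by
  have := hU.mono f
  obtain ⟨g, hg⟩ := hU.exists_lift_of_range_subset (𝟙 B) f (by rw [hf.range_eq]; simp)
  exact ⟨g, by rw [← cancel_mono f, Category.assoc, hg, Category.comp_id, Category.id_comp], hg⟩

lemma reflectsIsomorphisms : U.ReflectsIsomorphisms where
  reflects f _ := hU.isIso_of_surjective f ((isIso_iff_bijective (U.map f)).1 inferInstance).2

/-- The image of the comparison map from a directed colimit to a cocone. -/
lemma range_map_desc {J : Type w} [SmallCategory J] [IsFiltered J] {D : J ⥤ K}
    {c : Cocone D} (hc : IsColimit c) (s : Cocone D) :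
    Set.range (U.map (hc.desc s)) = ⋃ j, Set.range (U.map (s.ι.app j)) := by
  have := hU.preservesDirectedColimits.preservesColimitsOfShape J
  ext x
  simp only [Set.mem_range, Set.mem_iUnion]
  constructor
  · rintro ⟨y, rfl⟩
    obtain ⟨j, z, rfl⟩ := Types.jointly_surjective_of_isColimit (isColimitOfPreserves U hc) y
    refine ⟨j, z, ?_⟩
    rw [← hc.fac s j, U.map_comp]
    rfl
  · rintro ⟨j, z, rfl⟩
    refine ⟨U.map (c.ι.app j) z, ?_⟩
    rw [← hc.fac s j, U.map_comp]
    rfl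

/-- A filtered cocone is a colimit cocone if it is jointly surjective. -/
lemma isColimit_of_jointly_surjective {J : Type w} [SmallCategory J] [IsFiltered J] {D : J ⥤ K}
    (s : Cocone D) (hs : ∀ x : U.obj s.pt, ∃ j y, U.map (s.ι.app j) y = x) :
    Nonempty (IsColimit s) := by
  have := hU.hasDirectedColimits.hasColimitsOfShape J
  have : IsIso ((colimit.isColimit D).desc s) := hU.isIso_of_surjective _ (by
    rw [← Set.range_eq_univ, hU.range_map_desc]
    exact Set.eq_univ_of_forall fun x => Set.mem_iUnion.2 (hs x))
  exact ⟨(colimit.isColimit D).ofPointIso⟩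

/-- A monotone family of strong subsets of `A` underlies a diagram of subobjects of `A`. -/
lemma exists_diagram {J : Type w} [Preorder J] {A : K} (S : J → Set (U.obj A)) (hS : Monotone S)
    (hS' : ∀ j, IsStrong U (S j)) :
    ∃ (D : J ⥤ K) (s : D ⟶ (Functor.const J).obj A), ∀ j, Set.range (U.map (s.app j)) = S j := by
  choose B g hg using hS'
  choose f hf using fun (i j : J) (hij : i ≤ j) => hU.exists_lift_of_range_subset (g i) (g j)
    (by rw [hg, hg]; exact hS hij)
  have := fun j => hU.mono (g j)
  exact ⟨{ obj := B
           map := fun {i j} h => f i j (leOfHom h)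
           map_id := fun i => by rw [← cancel_mono (g i), hf, Category.id_comp]
           map_comp := fun {i j k} _ _ => by
             rw [← cancel_mono (g k), Category.assoc, hf, hf, hf] },
    { app := g
      naturality := fun i j h => by simp [hf] }, hg⟩

/-- Unions of directed families of strong subsets are strong. -/
lemma isStrong_sUnion {A : K} (𝒮 : Set (Set (U.obj A))) (h𝒮 : DirectedOn (· ⊆ ·) 𝒮)
    (hn : 𝒮.Nonempty) (h : ∀ X ∈ 𝒮, IsStrong U X) : IsStrong U (⋃₀ 𝒮) := by
  obtain ⟨D, s, hs⟩ := hU.exists_diagram (J := 𝒮) Subtype.val (Subtype.mono_coe _) fun X => h _ X.2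
  have : IsDirectedOrder 𝒮 := ⟨fun X Y => by
    obtain ⟨Z, hZ, h₁, h₂⟩ := h𝒮 _ X.2 _ Y.2
    exact ⟨⟨Z, hZ⟩, h₁, h₂⟩⟩
  have : Nonempty 𝒮 := hn.to_subtype
  have := hU.hasDirectedColimits 𝒮
  refine ⟨_, (colimit.isColimit D).desc ⟨A, s⟩, ?_⟩
  rw [hU.range_map_desc, Set.sUnion_eq_iUnion]
  exact Set.iUnion_congr hs

/-- The union of a chain interleaved with a sequence of strong subsets is strong. -/
lemma isStrong_iUnion_of_interleaved {A : K} (Y : ℕ → Set (U.obj A))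
    (h : ∀ n, ∃ Z, Y n ⊆ Z ∧ Z ⊆ Y (n + 1) ∧ IsStrong U Z) : IsStrong U (⋃ n, Y n) := by
  choose Z h₁ h₂ h₃ using h
  have hZ : Monotone Z := monotone_nat_of_le_succ fun n => (h₂ n).trans (h₁ (n + 1))
  have e : ⋃ n, Y n = ⋃₀ Set.range Z := by
    rw [Set.sUnion_range]
    exact subset_antisymm (Set.iUnion_mono h₁)
      (Set.iUnion_subset fun n => (h₂ n).trans (Set.subset_iUnion _ _))
  rw [e]
  refine hU.isStrong_sUnion _ ?_ (Set.range_nonempty _) ?_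
  · rintro _ ⟨m, rfl⟩ _ ⟨n, rfl⟩
    exact ⟨_, ⟨max m n, rfl⟩, hZ (le_max_left m n), hZ (le_max_right m n)⟩
  · rintro _ ⟨n, rfl⟩
    exact h₃ n

end IsCoherentConcrete

end Strong

/-! ### Accessibility and the Löwenheim–Skolem property -/

section LowenheimSkolem

variable {K : Type (w + 1)} [Category.{w} K]

/-- A property of objects is essentially small if its objects are determined up to isomorphism by
codes from a small type. -/
lemma essentiallySmall_of_code (P : ObjectProperty K) {T : Type u} [Small.{w} T]
    (Φ : K → T → Prop) (h₁ : ∀ A, P A → ∃ t, Φ A t)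
    (h₂ : ∀ A A' t, Φ A t → Φ A' t → Nonempty (A ≅ A')) :
    ObjectProperty.EssentiallySmall.{w} P where
  exists_small_le' := by
    refine ⟨.ofObj fun t : {t : T // ∃ A, Φ A t} => t.2.choose, inferInstance, fun A hA => ?_⟩
    obtain ⟨t, ht⟩ := h₁ A hA
    let t' : {t : T // ∃ A, Φ A t} := ⟨t, A, ht⟩
    exact ⟨_, ⟨t'⟩, h₂ _ _ t ht t'.2.choose_spec⟩

variable (U : K ⥤ Type w)

/-- The property of objects whose underlying set has cardinality `< κ`. -/
def cardinalLT (κ : Cardinal.{w}) : ObjectProperty K := fun A => HasCardinalLT (U.obj A) κ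

/-- The downward Löwenheim–Skolem property at `κ`, together with the condition that there is
only a set of objects of cardinality `< κ` up to isomorphism. -/
structure IsLowenheimSkolem (κ : Cardinal.{w}) : Prop where
  exists_isStrong : ∀ (A : K) (X : Set (U.obj A)), HasCardinalLT X κ →
    ∃ Y : Set (U.obj A), X ⊆ Y ∧ HasCardinalLT Y κ ∧ IsStrong U Y
  essentiallySmall : ObjectProperty.EssentiallySmall.{w} (cardinalLT U κ)

variable {U} (hU : IsCoherentConcrete U)

include hU

lemma IsCoherentConcrete.isCardinalPresentable {κ : Cardinal.{w}} [Fact κ.IsRegular] {A : K}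
    (hA : HasCardinalLT (U.obj A) κ) : IsCardinalPresentable A κ where
  preservesColimitOfShape J _ _ :=
    ⟨fun {D} => ⟨fun {c} hc => ⟨by
      have := isFiltered_of_isCardinalFiltered J κ
      have := hU.faithful
      have := hU.preservesDirectedColimits.preservesColimitsOfShape J
      refine Types.FilteredColimit.isColimitOf' _ _ (fun (f : A ⟶ c.pt) => ?_)
        (fun j (f : A ⟶ D.obj j) (g : A ⟶ D.obj j) h => ?_)
      · have := hA.isCardinalPresentable
        obtain ⟨j, f', hf'⟩ := IsCardinalPresentable.exists_hom_of_isColimit κ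
          (isColimitOfPreserves U hc) (U.map f)
        obtain ⟨f'', rfl⟩ := hU.coherent f (c.ι.app j) f' hf'
        refine ⟨j, f'', U.map_injective ?_⟩
        change U.map f = U.map (f'' ≫ c.ι.app j)
        rw [U.map_comp]
        exact hf'.symm
      · have := hU.mono (c.ι.app j)
        have h' : f ≫ c.ι.app j = g ≫ c.ι.app j := h
        exact ⟨j, 𝟙 j, by rw [(cancel_mono (c.ι.app j)).1 h']⟩⟩⟩⟩

/-- Löwenheim–Skolem implies accessibility: the objects of cardinality `< κ` are `κ`-presentable by
coherence, and every object is the `κ`-directed union of its strong subsets of cardinality `< κ`. -/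
lemma IsLowenheimSkolem.isCardinalAccessibleCategory {κ : Cardinal.{w}} [Fact κ.IsRegular]
    (h : IsLowenheimSkolem U κ) : IsCardinalAccessibleCategory K κ where
  exists_generator := by
    refine ⟨cardinalLT U κ, h.essentiallySmall,
      ⟨fun A hA => hU.isCardinalPresentable hA, fun A => ?_⟩⟩
    let J := {X : Set (U.obj A) // HasCardinalLT X κ ∧ IsStrong U X}
    have hJ : IsCardinalFiltered J κ := isCardinalFiltered_preorder _ _ fun ι S hι => by
      obtain ⟨Y, h₁, h₂, h₃⟩ := h.exists_isStrong A (⋃ i, (S i).1)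
        (hasCardinalLT_iUnion _ (by rwa [hasCardinalLT_iff_cardinal_mk_lt]) fun i => (S i).2.1)
      exact ⟨⟨Y, h₂, h₃⟩, fun i => (Set.subset_iUnion (fun i => (S i).1) i).trans h₁⟩
    have := isFiltered_of_isCardinalFiltered J κ
    obtain ⟨D, s, hs⟩ := hU.exists_diagram (J := J) Subtype.val (Subtype.mono_coe _) fun X => X.2.2
    obtain ⟨hc⟩ := hU.isColimit_of_jointly_surjective ⟨A, s⟩ (by
      intro x
      obtain ⟨Y, h₁, h₂, h₃⟩ := h.exists_isStrong A {x}
        (hasCardinalLT_of_finite _ _ (Cardinal.IsRegular.aleph0_le Fact.out))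
      have hx : x ∈ Set.range (U.map (s.app ⟨Y, h₂, h₃⟩)) := by
        rw [hs]
        exact h₁ rfl
      exact ⟨_, hx⟩)
    refine ⟨J, inferInstance, hJ, ⟨{ diag := D, ι := s, isColimit := hc, prop_diag_obj := ?_ }⟩⟩
    intro j
    have := j.2.1
    rw [← hs j] at this
    exact (hasCardinalLT_iff_of_equiv (Equiv.ofInjective _ (hU.map_injective (s.app j))) κ).2 this
  hasColimitsOfShape J _ _ := by
    have := isFiltered_of_isCardinalFiltered J κ
    exact hU.hasDirectedColimits.hasColimitsOfShape J

lemma IsLowenheimSkolem.isAccessibleCategory {κ : Cardinal.{w}} (hκ : κ.IsRegular)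
    (h : IsLowenheimSkolem U κ) : IsAccessibleCategory.{w} K := by
  have : Fact κ.IsRegular := ⟨hκ⟩
  exact ⟨κ, inferInstance, h.isCardinalAccessibleCategory hU⟩

/-- Accessibility implies Löwenheim–Skolem: a set of cardinality `< κ` is covered by fewer than `κ`
terms of a directed diagram, and these are contained in a directed subdiagram of size `< κ`. -/
lemma IsCoherentConcrete.exists_isLowenheimSkolem (hK : IsAccessibleCategory.{w} K) :
    ∃ κ₀ : Cardinal.{w}, Cardinal.aleph0 ≤ κ₀ ∧
      ∀ κ : Cardinal.{w}, κ.IsRegular → κ₀ < κ → IsLowenheimSkolem U κ := by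
  obtain ⟨μ, _, _⟩ := hK.exists_cardinal
  obtain ⟨P, _, hP⟩ := HasCardinalFilteredGenerator.exists_small_generator K μ
  obtain ⟨κ₁, hκ₁, hP₁⟩ := HasCardinalLT.exists_regular_cardinal_forall.{w}
    (fun p : Subtype P => U.obj p.1)
  refine ⟨κ₁, hκ₁.aleph0_le, fun κ hκ hlt => ?_⟩
  have : Fact κ.IsRegular := ⟨hκ⟩
  have hκ' : Cardinal.aleph0 < κ := hκ₁.aleph0_le.trans_lt hlt
  have key : ∀ (A : K) (X : Set (U.obj A)), HasCardinalLT X κ →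
      ∃ (B : K) (g : B ⟶ A), P.colimitsCardinalClosure κ B ∧ X ⊆ Set.range (U.map g) ∧
        HasCardinalLT (Set.range (U.map g)) κ := by
    intro A X hX
    obtain ⟨J₀, _, _, ⟨p₀⟩⟩ := hP.exists_colimitsOfShape A
    have := isFiltered_of_isCardinalFiltered J₀ μ
    obtain ⟨J, _, _, _, G, _⟩ := IsFiltered.exists_directed J₀
    let D := G ⋙ p₀.diag
    let c : Cocone D := (Cocone.mk A p₀.ι).whisker G
    have hc : IsColimit c := (Functor.Final.isColimitWhiskerEquiv G _).symm p₀.isColimit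
    have hD : ∀ j, P (D.obj j) := fun j => p₀.prop_diag_obj _
    have := hU.preservesDirectedColimits J
    choose a ha using fun x : U.obj A =>
      Types.jointly_surjective_of_isColimit (isColimitOfPreserves U hc) x
    choose m hm₁ hm₂ using fun i j : J => exists_ge_ge i j
    obtain ⟨S, hS₁, hS₂, hS₃⟩ := exists_closed_under_binary hκ' m
      ({Classical.arbitrary J} ∪ a '' X)
      (hasCardinalLT_union hκ.aleph0_le (hasCardinalLT_of_finite _ _ hκ.aleph0_le)
        (hX.of_surjective (fun x => ⟨a x, x, x.2, rfl⟩) (by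
          rintro ⟨_, x, hx, rfl⟩
          exact ⟨⟨x, hx⟩, rfl⟩)))
    have : IsDirectedOrder S := ⟨fun i j =>
      ⟨⟨m i j, hS₃ i i.2 j j.2⟩, hm₁ i j, hm₂ i j⟩⟩
    have : Nonempty S := ⟨_, hS₁ (Or.inl rfl)⟩
    have := hU.hasDirectedColimits S
    let incl : S ⥤ J := (Subtype.mono_coe (· ∈ S)).functor
    have hcl := P.isClosedUnderColimitsOfShape_colimitsCardinalClosure κ S
      ((hasCardinalLT_prod hκ.aleph0_le hS₂ hS₂).of_injective
        (fun f : Arrow S => (f.left, f.right)) (by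
          rintro ⟨x, y, f⟩ ⟨x', y', f'⟩ h
          cases (Prod.ext_iff.1 h).1
          cases (Prod.ext_iff.1 h).2
          rw [Subsingleton.elim (α := x ⟶ y) f f']))
    have hr := hU.range_map_desc (colimit.isColimit (incl ⋙ D)) (c.whisker incl)
    refine ⟨_, (colimit.isColimit (incl ⋙ D)).desc (c.whisker incl),
      hcl.colimitsOfShape_le _ ⟨⟨.colimit (incl ⋙ D),
        fun j => P.le_colimitsCardinalClosure κ _ (hD _)⟩⟩, ?_, ?_⟩
    · rw [hr]
      intro x hx
      obtain ⟨y, hy⟩ := ha x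
      exact Set.mem_iUnion.2 ⟨⟨a x, hS₁ (Or.inr ⟨x, hx, rfl⟩)⟩, y, hy⟩
    · rw [hr]
      refine hasCardinalLT_iUnion _ hS₂ fun j => ?_
      exact ((hP₁ ⟨_, hD j⟩).of_le hlt.le).of_surjective _ Set.rangeFactorization_surjective
  refine ⟨fun A X hX => ?_, ObjectProperty.EssentiallySmall.of_le
    (Q := P.colimitsCardinalClosure κ) fun A hA => ?_⟩
  · obtain ⟨B, g, -, h₁, h₂⟩ := key A X hX
    exact ⟨_, h₁, h₂, B, g, rfl⟩
  · obtain ⟨B, g, hB, h₁, -⟩ := key A Set.univ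
      ((hasCardinalLT_iff_of_equiv (Equiv.Set.univ _) κ).2 hA)
    have := hU.isIso_of_surjective g (Set.range_eq_univ.1 (Set.univ_subset_iff.1 h₁))
    exact (P.colimitsCardinalClosure κ).prop_of_iso (asIso g) hB

end LowenheimSkolem

/-! ### Isomorphisms of the canonical structures -/

/-- The underlying map of an embedding of structures. -/
def embFun {S : FirstOrder.Language.{0, v}} {M N : Emb.{w} S} (f : M ⟶ N) :
    M.carrier ⟶ N.carrier :=
  ↾(show S.Embedding M.carrier N.carrier from f).toFun

lemma embFun_ext {S : FirstOrder.Language.{0, v}} {M N : Emb.{w} S} {f g : M ⟶ N}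
    (h : embFun f = embFun g) : f = g :=
  FirstOrder.Language.Embedding.ext fun x => ConcreteCategory.congr_hom h x

lemma embFun_id {S : FirstOrder.Language.{0, v}} (M : Emb.{w} S) : embFun (𝟙 M) = 𝟙 _ := rfl

lemma embFun_comp {S : FirstOrder.Language.{0, v}} {M N Q : Emb.{w} S} (f : M ⟶ N) (g : N ⟶ Q) :
    embFun (f ≫ g) = embFun f ≫ embFun g := rfl

lemma embFun_map_rel {S : FirstOrder.Language.{0, v}} {M N : Emb.{w} S} (f : M ⟶ N) {n : ℕ}
    (R : S.Relations n) (a : Fin n → M.carrier) :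
    N.str.RelMap R (fun i => embFun f (a i)) ↔ M.str.RelMap R a :=
  (show S.Embedding M.carrier N.carrier from f).map_rel' R a

/-- The underlying bijection of an isomorphism of structures. -/
def embIso {S : FirstOrder.Language.{0, v}} {M N : Emb.{w} S} (e : M ≅ N) :
    M.carrier ≅ N.carrier where
  hom := embFun e.hom
  inv := embFun e.inv
  hom_inv_id := by rw [← embFun_comp, e.hom_inv_id, embFun_id]
  inv_hom_id := by rw [← embFun_comp, e.inv_hom_id, embFun_id]

section

variable {K : Type (w + 1)} [Category.{w} K] {U : K ⥤ Type w}

lemma canonicalStructure_ext (A : K) (M : Emb.{w} (signature U)) (h : U.obj A = M.carrier)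
    (hR : ∀ (n : ℕ) (R : InterpretableRelation U n) (a : Fin n → U.obj A),
      a ∈ R.rel A ↔ M.str.RelMap (n := n) R (fun i => eqToHom h (a i))) :
    canonicalStructure U A = M := by
  obtain ⟨X, str⟩ := M
  dsimp at h
  subst h
  refine congrArg (Emb.mk (U.obj A)) ?_
  refine FirstOrder.Language.Structure.ext ?_ ?_
  · ext n f
    exact PEmpty.elim f
  · ext n R a
    exact hR n R a

/-- A lift of the underlying bijection of an isomorphism of structures has that structure as its
codomain, since all structure is transported along the bijection. -/
lemma canonicalStructure_eq_of_lift {A B : K} {M : Emb.{w} (signature U)}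
    (e : canonicalStructure U A ⟶ M) (p : A ≅ B) (h : U.obj B = M.carrier)
    (hp : U.map p.hom ≫ eqToHom h = embFun e) : canonicalStructure U B = M := by
  refine canonicalStructure_ext B M h fun n R a => ?_
  have hs : ∀ x, U.map p.hom (U.map p.inv x) = x := fun x => by
    rw [← Functor.map_comp_apply, p.inv_hom_id]
    simp
  have h₁ : a ∈ R.rel B ↔ (fun i => U.map p.inv (a i)) ∈ R.rel A :=
    ⟨R.map_mem p.inv a, R.mem_of_map_mem p.inv a⟩
  have hx : ∀ x, eqToHom h x = embFun e (U.map p.inv x) := fun x => by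
    rw [← hp]
    change _ = eqToHom h (U.map p.hom (U.map p.inv x))
    rw [hs]
  rw [h₁, show (fun i => eqToHom h (a i)) = _ from funext fun i => hx (a i)]
  exact (embFun_map_rel e (show (signature U).Relations n from R)
    (fun i => U.map p.inv (a i))).symm

/-- The codomain of a lift of a bijection carries the transported structure, so that lifting
bijections is all that repleteness asks for. -/
lemma LiftsIsos.isReplete (hU : HasConcreteMonos U) (h : LiftsIsos U) :
    IsReplete (canonicalFunctor U hU) := by
  rintro A M ⟨e⟩
  obtain ⟨⟨B, p⟩, hB, hp⟩ := h (embIso e)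
  exact ⟨B, ⟨p⟩, canonicalStructure_eq_of_lift e.hom p hB hp⟩

lemma exists_lift_of_isFullOnIsos {hU : HasConcreteMonos U}
    (hfull : IsFullOnIsos (canonicalFunctor U hU)) {A B : K} {M : Emb.{w} (signature U)}
    (e : (canonicalFunctor U hU).obj A ≅ M) (hB : (canonicalFunctor U hU).obj B = M) :
    ∃ (p : A ≅ B) (h : U.obj B = M.carrier), U.map p.hom ≫ eqToHom h = embFun e.hom := by
  subst hB
  obtain ⟨p, hp⟩ := hfull e
  refine ⟨p, rfl, ?_⟩
  rw [← hp]
  rfl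

/-- The canonical structure of `A`, transported along a bijection `U A ≅ X`. -/
def transportedStructure {A : K} {X : Type w} (f : U.obj A ≅ X) : Emb.{w} (signature U) where
  carrier := X
  str :=
    { funMap := fun f => PEmpty.elim f
      RelMap := fun R a => (fun i => f.inv (a i)) ∈ InterpretableRelation.rel R A }

/-- The bijection `f`, as an isomorphism onto the transported structure. -/
def transportedStructureIso {A : K} {X : Type w} (f : U.obj A ≅ X) :
    canonicalStructure U A ≅ transportedStructure f :=
  have h₁ : ∀ x, f.inv (f.hom x) = x := fun x => by simp
  have h₂ : ∀ x, f.hom (f.inv x) = x := fun x => by simp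
  { hom := show (signature U).Embedding (canonicalStructure U A).carrier
        (transportedStructure f).carrier from
      { toFun := fun a => f.hom a
        inj' := Function.LeftInverse.injective h₁
        map_fun' := fun g _ => PEmpty.elim g
        map_rel' := fun R a => by
          change (fun i => f.inv (f.hom (a i))) ∈ InterpretableRelation.rel R A ↔ _
          rw [show (fun i => f.inv (f.hom (a i))) = a from funext fun i => h₁ (a i)]
          rfl }
    inv := show (signature U).Embedding (transportedStructure f).carrier
        (canonicalStructure U A).carrier from
      { toFun := fun a => f.inv a
        inj' := Function.LeftInverse.injective h₂
        map_fun' := fun g _ => PEmpty.elim g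
        map_rel' := fun R a => Iff.rfl }
    hom_inv_id := FirstOrder.Language.Embedding.ext h₁
    inv_hom_id := FirstOrder.Language.Embedding.ext h₂ }

/-- Transport the canonical structure along the bijection, realize the result by repleteness, and
correct the isomorphism by fullness on isomorphisms. -/
lemma liftsIsos_of_isReplete {hU : HasConcreteMonos U}
    (hfull : IsFullOnIsos (canonicalFunctor U hU)) (hrep : IsReplete (canonicalFunctor U hU)) :
    LiftsIsos U := by
  intro A X f
  let e : (canonicalFunctor U hU).obj A ≅ transportedStructure f := transportedStructureIso f
  obtain ⟨B, -, hB⟩ := hrep ⟨e⟩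
  obtain ⟨p, h, hp⟩ := exists_lift_of_isFullOnIsos hfull e hB
  exact ⟨⟨B, p⟩, h, hp⟩

lemma IsAEC.liftsIsos (h : IsAEC U) : LiftsIsos U := liftsIsos_of_isReplete h.isoFull h.replete

lemma IsAEC.isTransportable (h : IsAEC U)
    (hE : Function.Injective (canonicalFunctor U h.concreteMonos).obj) : IsTransportable U := by
  have := h.concreteDirectedColimits.faithful
  intro A X f
  refine existsUnique_of_exists_of_unique (h.liftsIsos f) ?_
  rintro ⟨B, p⟩ ⟨B', p'⟩ ⟨hB, hp⟩ ⟨hB', hp'⟩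
  dsimp only at hB hp hB' hp'
  subst hB
  obtain rfl : B' = B := hE (canonicalStructure_eq_of_lift
    ((canonicalFunctor U h.concreteMonos).map p.hom) p' hB'
      (hp'.trans (hp.symm.trans (Category.comp_id (U.map p.hom)))))
  congr 1
  ext
  refine U.map_injective ?_
  simpa using hp.trans hp'.symm

/-- An isomorphism of canonical structures of `(M, W)` is one of canonical structures of `(K, U)`
for every concrete functor `Q : M ⥤ K`, as the relation symbols of `K` can be interpreted in `M`. -/
lemma IsAEC.exists_iso_of_concrete (hU : IsAEC U) {M : Type (w + 1)} [Category.{w} M]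
    {W : M ⥤ Type w} (hW : HasConcreteMonos W) (Q : M ⥤ K) (hQ : Q ⋙ U = W) {A B : M}
    (e : (canonicalFunctor W hW).obj A ≅ (canonicalFunctor W hW).obj B) :
    ∃ g : Q.obj A ≅ Q.obj B, U.map g.hom ≫ (eqToHom hQ).app B =
      (eqToHom hQ).app A ≫ embFun e.hom := by
  subst hQ
  let R' {n : ℕ} (R : InterpretableRelation U n) : InterpretableRelation (Q ⋙ U) n :=
    { rel := fun A => R.rel (Q.obj A)
      map_mem := fun _ _ f => R.map_mem (Q.map f)
      mem_of_map_mem := fun _ _ f => R.mem_of_map_mem (Q.map f) }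
  have h₁ : ∀ x, embFun e.inv (embFun e.hom x) = x := fun x => (embIso e).hom_inv_id_apply x
  have h₂ : ∀ x, embFun e.hom (embFun e.inv x) = x := fun x => (embIso e).inv_hom_id_apply x
  let i₁ : (signature U).Embedding (canonicalStructure U (Q.obj A)).carrier
      (canonicalStructure U (Q.obj B)).carrier :=
    { toFun := fun a => embFun e.hom a
      inj' := Function.LeftInverse.injective h₁
      map_fun' := fun g _ => PEmpty.elim g
      map_rel' := fun R a => embFun_map_rel e.hom (R' R) a }
  let i₂ : (signature U).Embedding (canonicalStructure U (Q.obj B)).carrier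
      (canonicalStructure U (Q.obj A)).carrier :=
    { toFun := fun a => embFun e.inv a
      inj' := Function.LeftInverse.injective h₂
      map_fun' := fun g _ => PEmpty.elim g
      map_rel' := fun R a => embFun_map_rel e.inv (R' R) a }
  obtain ⟨g, hg⟩ := hU.isoFull (A := Q.obj A) (B := Q.obj B)
    { hom := i₁
      inv := i₂
      hom_inv_id := FirstOrder.Language.Embedding.ext h₁
      inv_hom_id := FirstOrder.Language.Embedding.ext h₂ }
  refine ⟨g, ?_⟩
  have := congrArg (fun e => embFun e.hom) hg
  exact (Category.comp_id _).trans (this.trans (Category.id_comp (embFun e.hom)).symm)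

/-- A recognition principle for abstract elementary classes. -/
lemma IsCoherentConcrete.isAEC (hU : IsCoherentConcrete U) {κ : Cardinal.{w}} (hκ : κ.IsRegular)
    (hLS : IsLowenheimSkolem U κ) (hlift : LiftsIsos U)
    (hfull : ∀ {A B : K} (e : (canonicalFunctor U hU.hasConcreteMonos).obj A ≅
      (canonicalFunctor U hU.hasConcreteMonos).obj B),
      ∃ g : A ≅ B, U.map g.hom = embFun e.hom) : IsAEC U where
  concreteDirectedColimits :=
    { accessible := hLS.isAccessibleCategory hU hκ
      hasDirectedColimits := hU.hasDirectedColimits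
      faithful := hU.faithful
      preservesDirectedColimits := hU.preservesDirectedColimits }
  coherent := hU.coherent
  concreteMonos := hU.hasConcreteMonos
  isoFull A B e := by
    obtain ⟨g, hg⟩ := hfull e
    exact ⟨g, Iso.ext (embFun_ext hg)⟩
  replete := hlift.isReplete _

end

/-! ### Functors into abstract elementary classes -/

section

variable {K : Type (w + 1)} [Category.{w} K] {U : K ⥤ Type w} (hU : IsCoherentConcrete U)
  {T : Type (w + 1)} [Category.{w} T] (H : T ⥤ K)

include hU

/-- As `U` is conservative, it reflects the directed colimits that it preserves. -/
lemma IsCoherentConcrete.reflectsColimitsOfShape (J : Type w) [SmallCategory J] [IsFiltered J] :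
    ReflectsColimitsOfShape J U := by
  have := hU.reflectsIsomorphisms
  have := hU.hasDirectedColimits.hasColimitsOfShape J
  have := hU.preservesDirectedColimits.preservesColimitsOfShape J
  exact reflectsColimitsOfShape_of_reflectsIsomorphisms

lemma IsCoherentConcrete.preservesDirectedColimits_of_comp
    (h : PreservesDirectedColimits (H ⋙ U)) : PreservesDirectedColimits H := by
  intro J _ _ _
  have := h J
  have := hU.reflectsColimitsOfShape J
  exact preservesColimitsOfShape_of_reflects_of_preserves H U

lemma IsCoherentConcrete.isAccessible_of_comp (h : (H ⋙ U).IsAccessible.{w}) :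
    H.IsAccessible.{w} := by
  obtain ⟨κ, hκ, _⟩ := h
  have : H.IsCardinalAccessible κ :=
    { preservesColimitOfShape := fun J _ _ => by
        have := isFiltered_of_isCardinalFiltered J κ
        have := (H ⋙ U).preservesColimitsOfShape_of_isCardinalAccessible κ J
        have := hU.reflectsColimitsOfShape J
        exact preservesColimitsOfShape_of_reflects_of_preserves H U }
  exact Functor.isAccessible_of_isCardinalAccessible H κ

end

/-! ### Inserters of concrete functors -/

namespace Ins

variable {K L : Type (w + 1)} [Category.{w} K] [Category.{w} L] {F G : K ⥤ L}

@[ext] lemma hom_ext {X Y : Ins F G} {f g : X ⟶ Y} (h : f.hom = g.hom) : f = g := Hom.ext h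

instance : (proj F G).Faithful where
  map_injective h := hom_ext h

/-- Isomorphisms of `Ins(F, G)` from isomorphisms of the underlying objects. -/
def mkIso {X Y : Ins F G} (e : X.obj ≅ Y.obj) (h : X.str ≫ G.map e.hom = F.map e.hom ≫ Y.str) :
    X ≅ Y where
  hom := ⟨e.hom, h⟩
  inv := ⟨e.inv, by
    rw [← cancel_mono (G.map e.hom), ← cancel_epi (F.map e.hom), Category.assoc, Category.assoc,
      ← G.map_comp, e.inv_hom_id, G.map_id, Category.comp_id, ← h, ← F.map_comp_assoc,
      e.hom_inv_id, F.map_id, Category.id_comp]⟩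
  hom_inv_id := by ext; exact e.hom_inv_id
  inv_hom_id := by ext; exact e.inv_hom_id

/-- Transport of an object of `Ins(F, G)` along an isomorphism of `K`. -/
abbrev transportIso (X : Ins F G) {B : K} (p : X.obj ≅ B) :
    X ≅ ⟨B, F.map p.inv ≫ X.str ≫ G.map p.hom⟩ :=
  mkIso p (by simp [← F.map_comp_assoc])

/-! ### Colimits in inserters: the projection creates those that the domain functor preserves -/

section Colimits

variable {J : Type w} [Category.{w} J] (D : J ⥤ Ins F G)

/-- The diagram of the structure maps. -/
def strNatTrans : (D ⋙ proj F G) ⋙ F ⟶ (D ⋙ proj F G) ⋙ G :=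
  Functor.whiskerLeft D (Ins.trans F G)

variable {D} {c : Cocone (D ⋙ proj F G)}

/-- The structure map of the colimit. -/
def colimitStr (hF : IsColimit (F.mapCocone c)) : F.obj c.pt ⟶ G.obj c.pt :=
  hF.map (G.mapCocone c) (strNatTrans D)

lemma map_ι_colimitStr (hF : IsColimit (F.mapCocone c)) (j : J) :
    F.map (c.ι.app j) ≫ colimitStr hF = (D.obj j).str ≫ G.map (c.ι.app j) :=
  hF.ι_map (G.mapCocone c) (strNatTrans D) j

/-- The lift of a colimit cocone to `Ins(F, G)`. -/
def colimitCocone (hF : IsColimit (F.mapCocone c)) : Cocone D where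
  pt := ⟨c.pt, colimitStr hF⟩
  ι :=
    { app := fun j => ⟨c.ι.app j, (map_ι_colimitStr hF j).symm⟩
      naturality := fun i j f => by
        ext
        exact c.ι.naturality f }

lemma colimitStr_comp_map (hF : IsColimit (F.mapCocone c)) {X : Ins F G} (d : c.pt ⟶ X.obj)
    (f : ∀ j, D.obj j ⟶ X) (hd : ∀ j, c.ι.app j ≫ d = (f j).hom) :
    colimitStr hF ≫ G.map d = F.map d ≫ X.str :=
  hF.hom_ext fun j => by
    have key : ∀ i : (D.obj j).obj ⟶ c.pt, F.map i ≫ colimitStr hF = (D.obj j).str ≫ G.map i →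
        i ≫ d = (f j).hom →
        F.map i ≫ colimitStr hF ≫ G.map d = F.map i ≫ F.map d ≫ X.str := fun i h₁ h₂ => by
      rw [reassoc_of% h₁, ← F.map_comp_assoc, h₂, ← (f j).comm, ← h₂, G.map_comp]
    exact key _ (map_ι_colimitStr hF j) (hd j)

/-- The lift of a colimit cocone to `Ins(F, G)` is a colimit cocone. -/
def isColimitColimitCocone (hc : IsColimit c) (hF : IsColimit (F.mapCocone c)) :
    IsColimit (colimitCocone hF) where
  desc s := ⟨hc.desc ((proj F G).mapCocone s), colimitStr_comp_map hF _ s.ι.app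
    fun j => hc.fac ((proj F G).mapCocone s) j⟩
  fac s j := by
    ext
    exact hc.fac ((proj F G).mapCocone s) j
  uniq s m hm := by
    ext
    exact hc.uniq ((proj F G).mapCocone s) m.hom fun j => congrArg Hom.hom (hm j)

variable (F G) in
lemma hasColimitsOfShape [HasColimitsOfShape J K] [PreservesColimitsOfShape J F] :
    HasColimitsOfShape J (Ins F G) where
  has_colimit D := ⟨⟨⟨_, isColimitColimitCocone (colimit.isColimit (D ⋙ proj F G))
    (isColimitOfPreserves F (colimit.isColimit (D ⋙ proj F G)))⟩⟩⟩

variable (F G) in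
lemma preservesColimitsOfShape_proj [HasColimitsOfShape J K] [PreservesColimitsOfShape J F] :
    PreservesColimitsOfShape J (proj F G) where
  preservesColimit {D} := preservesColimit_of_preserves_colimit_cocone
    (isColimitColimitCocone (colimit.isColimit (D ⋙ proj F G))
      (isColimitOfPreserves F (colimit.isColimit (D ⋙ proj F G))))
    (colimit.isColimit (D ⋙ proj F G))

end Colimits

section Concrete

variable {U : K ⥤ Type w} {V : L ⥤ Type w} (α : F ⋙ V ≅ U) (β : G ⋙ V ≅ U)

/-- The unary operation on the underlying set of an object of the inserter of two concrete functors
which is given by the structure map. -/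
def op (X : Ins F G) : U.obj X.obj ⟶ U.obj X.obj :=
  α.inv.app X.obj ≫ V.map X.str ≫ β.hom.app X.obj

/-- A morphism of `K` is a morphism of `Ins(F, G)` precisely if it commutes with `op`. -/
lemma map_comp_op_iff (hV : V.Faithful) {X Y : Ins F G} (k : X.obj ⟶ Y.obj) :
    U.map k ≫ op α β Y = op α β X ≫ U.map k ↔ X.str ≫ G.map k = F.map k ≫ Y.str := by
  have h₁ : U.map k ≫ op α β Y = α.inv.app X.obj ≫ V.map (F.map k ≫ Y.str) ≫ β.hom.app Y.obj := by
    rw [op, α.inv.naturality_assoc, V.map_comp, Category.assoc]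
    rfl
  have h₂ : op α β X ≫ U.map k = α.inv.app X.obj ≫ V.map (X.str ≫ G.map k) ≫ β.hom.app Y.obj := by
    rw [op, Category.assoc, Category.assoc, ← β.hom.naturality, V.map_comp, Category.assoc]
    rfl
  rw [h₁, h₂, cancel_epi, cancel_mono, V.map_injective.eq_iff, eq_comm]

lemma map_op (hV : V.Faithful) {X Y : Ins F G} (f : X ⟶ Y) (x : U.obj X.obj) :
    op α β Y (U.map f.hom x) = U.map f.hom (op α β X x) :=
  ConcreteCategory.congr_hom ((map_comp_op_iff α β hV f.hom).2 f.comm) x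

lemma preservesDirectedColimits_proj (hU : IsCoherentConcrete U)
    (hF : PreservesDirectedColimits F) : PreservesDirectedColimits (proj F G) := by
  intro J _ _ _
  have := hU.hasDirectedColimits J
  have := hF J
  exact preservesColimitsOfShape_proj F G

lemma isCoherentConcrete (hU : IsCoherentConcrete U) (hV : IsCoherentConcrete V)
    (hF : PreservesDirectedColimits F) : IsCoherentConcrete (proj F G ⋙ U) where
  hasDirectedColimits J _ _ _ := by
    have := hU.hasDirectedColimits J
    have := hF J
    exact hasColimitsOfShape F G
  faithful := by
    have := hU.faithful
    infer_instance
  preservesDirectedColimits :=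
    (preservesDirectedColimits_proj hU hF).comp hU.preservesDirectedColimits
  coherent A B C h g f hf := by
    have := hU.faithful
    obtain ⟨f', hf'⟩ := hU.coherent h.hom g.hom f hf
    have e : f' ≫ g.hom = h.hom := U.map_injective (by
      rw [U.map_comp, hf']
      exact hf)
    have := hV.mono (G.map g.hom)
    refine ⟨⟨f', ?_⟩, hf'⟩
    rw [← cancel_mono (G.map g.hom), Category.assoc, Category.assoc, g.comm, ← G.map_comp, e,
      ← F.map_comp_assoc, e, h.comm]
  map_injective A B f := hU.map_injective f.hom

/-- Coherence of `L` restricts the structure map of `X` to every strong subset closed under `op`. -/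
lemma isStrong_of_closed (hV : IsCoherentConcrete V)
    {X : Ins F G} (Y : Set (U.obj X.obj)) (hY : IsStrong U Y) (hc : ∀ y ∈ Y, op α β X y ∈ Y) :
    IsStrong (proj F G ⋙ U) (A := X) Y := by
  obtain ⟨B, g, rfl⟩ := hY
  have := hV.faithful
  choose r hr using fun b => hc _ (Set.mem_range_self b)
  let r' : V.obj (F.obj B) ⟶ V.obj (G.obj B) := α.hom.app B ≫ ↾r ≫ β.inv.app B
  have hr' : (↾r : U.obj B ⟶ U.obj B) ≫ U.map g = U.map g ≫ op α β X := by
    ext b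
    exact hr b
  have e : r' ≫ V.map (G.map g) = V.map (F.map g ≫ X.str) := by
    have h₁ : β.inv.app B ≫ V.map (G.map g) = U.map g ≫ β.inv.app X.obj :=
      (β.inv.naturality g).symm
    have h₂ : α.hom.app B ≫ U.map g = V.map (F.map g) ≫ α.hom.app X.obj :=
      (α.hom.naturality g).symm
    simp only [r', Category.assoc, h₁, reassoc_of% hr', reassoc_of% h₂, op, V.map_comp]
    simp
  obtain ⟨s, hs⟩ := hV.coherent _ _ _ e
  refine ⟨⟨B, s⟩, ⟨g, V.map_injective ?_⟩, rfl⟩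
  rw [V.map_comp, hs, e]

include α β in
lemma isLowenheimSkolem (hU : IsCoherentConcrete U) (hV : IsCoherentConcrete V)
    {κ : Cardinal.{w}} (hκ : κ.IsRegular) (hκ' : Cardinal.aleph0 < κ)
    (h : IsLowenheimSkolem U κ) : IsLowenheimSkolem (proj F G ⋙ U) κ where
  exists_isStrong X S hS := by
    have : Fact κ.IsRegular := ⟨hκ⟩
    obtain ⟨Y, h₁, -, h₃, h₄⟩ := exists_chain_closing_off hκ' (T := U.obj X.obj) (ι := PUnit)
      (hasCardinalLT_of_finite _ _ hκ'.le)
      (fun _ Y Z => IsStrong U Z ∧ ∀ y ∈ Y, op α β X y ∈ Z)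
      (fun _ Y hY => by
        obtain ⟨Z, h₁, h₂, h₃⟩ := h.exists_isStrong X.obj (Y ∪ op α β X '' Y)
          (hasCardinalLT_union hκ'.le hY
            (hY.of_surjective _ Set.imageFactorization_surjective))
        exact ⟨Z, Set.subset_union_left.trans h₁, h₂, h₃, fun y hy => h₁ (Or.inr ⟨y, hy, rfl⟩)⟩)
      S hS
    refine ⟨⋃ n, Y n, h₁.trans (Set.subset_iUnion _ 0), h₃, isStrong_of_closed α β hV _
      (hU.isStrong_iUnion_of_interleaved Y fun n => ?_) fun y hy => ?_⟩
    · obtain ⟨Z, h₁, h₂, h₃, -⟩ := h₄ ⟨⟩ n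
      exact ⟨Z, h₁, h₂, h₃⟩
    · obtain ⟨n, hn⟩ := Set.mem_iUnion.1 hy
      obtain ⟨Z, h₁, h₂, -, h₃⟩ := h₄ ⟨⟩ n
      exact Set.mem_iUnion.2 ⟨n + 1, h₂ (h₃ y hn)⟩
  essentiallySmall := by
    have := h.essentiallySmall
    obtain ⟨Q, _, hQ, hQ'⟩ := ObjectProperty.EssentiallySmall.exists_small_le (cardinalLT U κ)
    refine essentiallySmall_of_code _ (T := Σ q : Subtype Q, (F.obj q.1 ⟶ G.obj q.1))
      (fun (X : Ins F G) (t : Σ q : Subtype Q, (F.obj q.1 ⟶ G.obj q.1)) =>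
        ∃ e : X.obj ≅ t.1.1, X.str ≫ G.map e.hom = F.map e.hom ≫ t.2) ?_ ?_
    · intro X hX
      obtain ⟨q, hq, ⟨e⟩⟩ := hQ' X.obj hX
      exact ⟨⟨⟨q, hq⟩, F.map e.inv ≫ X.str ≫ G.map e.hom⟩, e, by simp [← F.map_comp_assoc]⟩
    · rintro X X' ⟨q, t⟩ ⟨e, he⟩ ⟨e', he'⟩
      exact ⟨mkIso (Y := ⟨q.1, t⟩) e he ≪≫ (mkIso (Y := ⟨q.1, t⟩) e' he').symm⟩

lemma liftsIsos (hU : LiftsIsos U) : LiftsIsos (proj F G ⋙ U) := by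
  intro X S f
  obtain ⟨⟨B, p⟩, h, hp⟩ := hU f
  exact ⟨⟨_, X.transportIso p⟩, h, hp⟩

include α β in
lemma isAEC (hU : IsAEC U) (hV : IsAEC V) (hF : PreservesDirectedColimits F) :
    IsAEC (proj F G ⋙ U) := by
  have hI := isCoherentConcrete hU.isCoherentConcrete hV.isCoherentConcrete hF (G := G)
  have hV' := hV.isCoherentConcrete.faithful
  obtain ⟨κ₀, hκ₀, h⟩ := hU.isCoherentConcrete.exists_isLowenheimSkolem
    hU.concreteDirectedColimits.accessible
  have hκ := Cardinal.isRegular_succ hκ₀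
  have hlt := Order.lt_succ κ₀
  refine hI.isAEC hκ (isLowenheimSkolem α β hU.isCoherentConcrete hV.isCoherentConcrete hκ
    (hκ₀.trans_lt hlt) (h _ hκ hlt)) (liftsIsos hU.liftsIsos) ?_
  intro X Y e
  obtain ⟨g, hg⟩ := hU.exists_iso_of_concrete hI.hasConcreteMonos (proj F G) rfl e
  replace hg : U.map g.hom = embFun e.hom :=
    (Category.comp_id _).symm.trans (hg.trans (Category.id_comp (embFun e.hom)))
  -- the graph of `op` is a binary relation symbol, which `e` therefore preserves
  let R : InterpretableRelation (proj F G ⋙ U) 2 :=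
    { rel := fun X => {a | op α β X (a 0) = a 1}
      map_mem := fun X Y f a ha => by
        have ha' : op α β X (a 0) = a 1 := ha
        change op α β Y (U.map f.hom (a 0)) = U.map f.hom (a 1)
        exact (map_op α β hV' f (a 0)).trans (congrArg (U.map f.hom) ha')
      mem_of_map_mem := fun X Y f a ha => by
        replace ha : op α β Y (U.map f.hom (a 0)) = U.map f.hom (a 1) := ha
        exact hU.isCoherentConcrete.map_injective f.hom
          ((map_op α β hV' f (a 0)).symm.trans ha) }
  refine ⟨mkIso g ((map_comp_op_iff α β hV' g.hom).1 ?_), hg⟩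
  ext x
  have hx := (embFun_map_rel e.hom (show (signature (proj F G ⋙ U)).Relations 2 from R)
    (fun i : Fin 2 => if i = 0 then x else op α β X x)).2 rfl
  rw [← hg] at hx
  exact hx

end Concrete

/-! ### Functors to an inserter -/

section Lift

variable {T : Type (w + 1)} [Category.{w} T]

/-- The functor to `Ins(F, G)` given by a functor to `K` and a natural transformation. -/
def lift (H : T ⥤ K) (ψ : H ⋙ F ⟶ H ⋙ G) : T ⥤ Ins F G where
  obj t := ⟨H.obj t, ψ.app t⟩
  map f := ⟨H.map f, (ψ.naturality f).symm⟩

lemma eq_lift (H : T ⥤ Ins F G) (ψ : (H ⋙ proj F G) ⋙ F ⟶ (H ⋙ proj F G) ⋙ G)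
    (h : ∀ t, (H.obj t).str = ψ.app t) : H = lift (H ⋙ proj F G) ψ := by
  obtain rfl : ψ = Functor.whiskerLeft H (Ins.trans F G) := by
    ext t
    exact (h t).symm
  rfl

end Lift

end Ins

/-! ### Equifiers -/

section Equifier

variable {K L : Type (w + 1)} [Category.{w} K] [Category.{w} L] {U : K ⥤ Type w}

/-- A full subcategory of an abstract elementary class is one too if it is closed under subobjects
and under directed colimits. -/
lemma IsAEC.ι_comp (hU : IsAEC U) (P : ObjectProperty K)
    (hP₁ : ∀ {A B : K} (_ : A ⟶ B), P B → P A)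
    (hP₂ : ∀ (J : Type w) [PartialOrder J] [IsDirectedOrder J] [Nonempty J],
      P.IsClosedUnderColimitsOfShape J) :
    PreservesDirectedColimits P.ι ∧ IsAEC (P.ι ⋙ U) := by
  have hU' := hU.isCoherentConcrete
  have hι : PreservesDirectedColimits P.ι := fun J _ _ _ => by
    have := hP₂ J
    have := hU'.hasDirectedColimits J
    infer_instance
  have hE : IsCoherentConcrete (P.ι ⋙ U) :=
    { hasDirectedColimits := fun J _ _ _ => by
        have := hP₂ J
        have := hU'.hasDirectedColimits J
        exact hasColimitsOfShape_of_closedUnderColimits J P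
      faithful := by
        have := hU'.faithful
        infer_instance
      preservesDirectedColimits := hι.comp hU'.preservesDirectedColimits
      coherent := fun A B C h g f hf => by
        obtain ⟨f', hf'⟩ := hU'.coherent h.hom g.hom f hf
        exact ⟨ObjectProperty.homMk f', hf'⟩
      map_injective := fun A B f => hU'.map_injective f.hom }
  refine ⟨hι, ?_⟩
  obtain ⟨κ₀, hκ₀, h⟩ := hU'.exists_isLowenheimSkolem hU.concreteDirectedColimits.accessible
  have hκ := Cardinal.isRegular_succ hκ₀
  replace h := h _ hκ (Order.lt_succ κ₀)
  refine hE.isAEC hκ ⟨fun A X hX => ?_, ?_⟩ (fun A X f => ?_) fun {A B} e => ?_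
  · obtain ⟨Y, h₁, h₂, B, g, hg⟩ := h.exists_isStrong A.obj X hX
    exact ⟨Y, h₁, h₂, ⟨B, hP₁ g A.property⟩, ObjectProperty.homMk g, hg⟩
  · have := h.essentiallySmall
    obtain ⟨Q, _, hQ, hQ'⟩ := ObjectProperty.EssentiallySmall.exists_small_le
      (cardinalLT U (Order.succ κ₀))
    refine essentiallySmall_of_code _ (T := Subtype Q)
      (fun (A : P.FullSubcategory) q => Nonempty (A.obj ≅ q.1)) ?_ ?_
    · intro A hA
      obtain ⟨q, hq, e⟩ := hQ' A.obj hA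
      exact ⟨⟨q, hq⟩, e⟩
    · rintro A A' q ⟨e⟩ ⟨e'⟩
      exact ⟨P.isoMk (e ≪≫ e'.symm)⟩
  · obtain ⟨⟨B, p⟩, hB, hp⟩ := hU.liftsIsos f
    exact ⟨⟨⟨B, hP₁ p.inv A.property⟩, P.isoMk p⟩, hB, hp⟩
  · obtain ⟨g, hg⟩ := hU.exists_iso_of_concrete hE.hasConcreteMonos P.ι rfl e
    exact ⟨P.isoMk g, (Category.comp_id (U.map g.hom)).symm.trans
      (hg.trans (Category.id_comp (embFun e.hom)))⟩

variable {F G : K ⥤ L} {V : L ⥤ Type w}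

lemma Equif.isAEC (hU : IsAEC U) (hV : IsAEC V) (hF : PreservesDirectedColimits F)
    (φ ψ : F ⟶ G) :
    PreservesDirectedColimits (Equif.proj φ ψ) ∧ IsAEC (Equif.proj φ ψ ⋙ U) := by
  refine hU.ι_comp _ (fun {A B} f hB => ?_) fun J _ _ _ => ⟨fun A ⟨p⟩ => ?_⟩
  · have := hV.concreteMonos.mono (G.map f)
    have hB' : φ.app B = ψ.app B := hB
    rw [← cancel_mono (G.map f), ← φ.naturality, ← ψ.naturality, hB']
  · have := hF J
    refine (isColimitOfPreserves F p.isColimit).hom_ext fun j => ?_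
    have hj : φ.app (p.diag.obj j) = ψ.app (p.diag.obj j) := p.prop_diag_obj j
    exact (φ.naturality (p.ι.app j)).trans
      ((congrArg (· ≫ G.map (p.ι.app j)) hj).trans (ψ.naturality (p.ι.app j)).symm)

end Equifier

/-! ### Sets and injections -/

/-- The objects of the category of sets and injections, which is the terminal object of
`Acc3Star`. -/
structure InjSet where
  carrier : Type w

namespace InjSet

instance : Category.{w} InjSet.{w} where
  Hom X Y := {f : X.carrier ⟶ Y.carrier // Function.Injective f}
  id X := ⟨𝟙 X.carrier, fun _ _ h => h⟩
  comp f g := ⟨f.1 ≫ g.1, g.2.comp f.2⟩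

/-- The inclusion of the category of sets and injections. -/
def U : InjSet.{w} ⥤ Type w where
  obj X := X.carrier
  map f := f.1

instance : U.{w}.Faithful where
  map_injective h := Subtype.ext h

/-- A bijection is an isomorphism in the category of sets and injections. -/
def mkIso {X Y : InjSet.{w}} (e : X.carrier ≅ Y.carrier) : X ≅ Y where
  hom := ⟨e.hom, (mono_iff_injective e.hom).1 inferInstance⟩
  inv := ⟨e.inv, (mono_iff_injective e.inv).1 inferInstance⟩
  hom_inv_id := Subtype.ext e.hom_inv_id
  inv_hom_id := Subtype.ext e.inv_hom_id

section

variable {J : Type w} [SmallCategory J] [IsFiltered J] {D : J ⥤ InjSet.{w}}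
  {c : Cocone (D ⋙ U)}

lemma ι_injective (hc : IsColimit c) (j : J) : Function.Injective (c.ι.app j) := fun x y h => by
  obtain ⟨k, f, hf⟩ := (Types.FilteredColimit.isColimit_eq_iff' hc x y).1 h
  exact (D.map f).2 hf

/-- The colimit of a filtered diagram of injections. -/
def colimitCocone (hc : IsColimit c) : Cocone D where
  pt := ⟨c.pt⟩
  ι :=
    { app := fun j => ⟨c.ι.app j, ι_injective hc j⟩
      naturality := fun _ _ f => Subtype.ext (c.ι.naturality f) }

lemma desc_injective (hc : IsColimit c) (s : Cocone D) :
    Function.Injective (hc.desc (U.mapCocone s)) := fun x y h => by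
  obtain ⟨j, x, y, rfl, rfl⟩ := Types.FilteredColimit.jointly_surjective_of_isColimit₂ hc x y
  have hj : ∀ z, hc.desc (U.mapCocone s) (c.ι.app j z) = (s.ι.app j).1 z := fun z =>
    ConcreteCategory.congr_hom (hc.fac (U.mapCocone s) j) z
  have hxy := (hj x).symm.trans (h.trans (hj y))
  rw [(s.ι.app j).2 hxy]

/-- The colimit in sets of a filtered diagram of injections is its colimit among injections. -/
def isColimitColimitCocone (hc : IsColimit c) : IsColimit (colimitCocone hc) where
  desc s := ⟨hc.desc (U.mapCocone s), desc_injective hc s⟩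
  fac s j := Subtype.ext (hc.fac (U.mapCocone s) j)
  uniq s m hm := Subtype.ext (hc.uniq (U.mapCocone s) m.1 fun j => congrArg Subtype.val (hm j))

end

lemma isCoherentConcrete : IsCoherentConcrete U.{w} where
  hasDirectedColimits _ _ _ _ :=
    { has_colimit := fun D => ⟨⟨⟨_, isColimitColimitCocone (colimit.isColimit (D ⋙ U))⟩⟩⟩ }
  faithful := inferInstance
  preservesDirectedColimits _ _ _ _ :=
    { preservesColimit := fun {D} => preservesColimit_of_preserves_colimit_cocone
        (isColimitColimitCocone (colimit.isColimit (D ⋙ U))) (colimit.isColimit (D ⋙ U)) }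
  coherent _ _ _ h g f hf := ⟨⟨f, fun x y hxy => h.2 ((ConcreteCategory.congr_hom hf x).symm.trans
    ((congrArg g.1 hxy).trans (ConcreteCategory.congr_hom hf y)))⟩, rfl⟩
  map_injective _ _ f := f.2

lemma isLowenheimSkolem {κ : Cardinal.{w}} : IsLowenheimSkolem U.{w} κ where
  exists_isStrong A X hX := ⟨X, subset_rfl, hX, ⟨X⟩, ⟨↾Subtype.val, Subtype.val_injective⟩,
    Subtype.range_val⟩
  essentiallySmall := by
    refine essentiallySmall_of_code _ (T := Set κ.out)
      (fun A S => Nonempty (A.carrier ≃ S)) (fun A hA => ?_) ?_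
    · have hA' : Cardinal.mk A.carrier < Cardinal.mk κ.out := by
        rw [Cardinal.mk_out]
        exact (hasCardinalLT_iff_cardinal_mk_lt _ _).1 hA
      obtain ⟨f⟩ := hA'.le
      exact ⟨Set.range f, ⟨Equiv.ofInjective f f.injective⟩⟩
    · rintro A A' S ⟨e⟩ ⟨e'⟩
      exact ⟨mkIso (e.trans e'.symm).toIso⟩

lemma isAEC : IsAEC U.{w} :=
  isCoherentConcrete.isAEC Cardinal.isRegular_aleph0 isLowenheimSkolem
    (fun _ X f => ⟨⟨⟨X⟩, mkIso f⟩, rfl, Category.comp_id f.hom⟩)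
    fun e => ⟨mkIso (embIso e), rfl⟩

/-- The functor to sets and injections underlying a concrete category. -/
def lift {T : Type (w + 1)} [Category.{w} T] {W : T ⥤ Type w} (hW : IsCoherentConcrete W) :
    T ⥤ InjSet.{w} where
  obj t := ⟨W.obj t⟩
  map f := ⟨W.map f, hW.map_injective f⟩
  map_id t := Subtype.ext (W.map_id t)
  map_comp f g := Subtype.ext (W.map_comp f g)

lemma eq_lift {T : Type (w + 1)} [Category.{w} T] {W : T ⥤ Type w} (hW : IsCoherentConcrete W)
    (H : T ⥤ InjSet.{w}) (h : H ⋙ U = W) : H = lift hW := by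
  subst h
  rfl

end InjSet

/-! ### Multiple pullbacks over the category of sets -/

namespace MultiPullback

variable {I : Type w} {K : I → Type (w + 1)} [∀ i, Category.{w} (K i)]
  {U : ∀ i, K i ⥤ Type w}

/-- The identification of the underlying set of a component with the common underlying set. -/
def compIso (X : MultiPullback U) (i : I) : (U i).obj (X.obj i) ≅ X.base := eqToIso (X.obj_eq i)

lemma map_app_comp {X Y : MultiPullback U} (f : X ⟶ Y) (i : I) :
    (U i).map (f.app i) ≫ (Y.compIso i).hom = (X.compIso i).hom ≫ f.base := f.comm i

lemma map_app_comp_assoc {X Y : MultiPullback U} (f : X ⟶ Y) (i : I) {Z : Type w}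
    (h : Y.base ⟶ Z) :
    (U i).map (f.app i) ≫ (Y.compIso i).hom ≫ h = (X.compIso i).hom ≫ f.base ≫ h := by
  have := congrArg (· ≫ h) (map_app_comp f i)
  simpa only [Category.assoc] using this

lemma hom_ext (hU : ∀ i, (U i).Faithful) {X Y : MultiPullback U} {f g : X ⟶ Y}
    (h : f.base = g.base) : f = g := by
  refine Hom.ext h (funext fun i => ?_)
  have := hU i
  refine (U i).map_injective ?_
  rw [← cancel_mono (Y.compIso i).hom, map_app_comp, map_app_comp, h]

lemma hom_ext_app [Nonempty I] {X Y : MultiPullback U} {f g : X ⟶ Y}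
    (h : ∀ i, f.app i = g.app i) : f = g := by
  let i : I := Classical.arbitrary I
  refine Hom.ext ?_ (funext h)
  rw [← cancel_epi (X.compIso i).hom, ← map_app_comp, ← map_app_comp, h]

/-- Isomorphisms in the multiple pullback are compatible families of isomorphisms. -/
def mkIso {X Y : MultiPullback U} (b : X.base ≅ Y.base) (e : ∀ i, X.obj i ≅ Y.obj i)
    (h : ∀ i, (U i).map (e i).hom ≫ (Y.compIso i).hom = (X.compIso i).hom ≫ b.hom) : X ≅ Y where
  hom := ⟨b.hom, fun i => (e i).hom, h⟩
  inv := ⟨b.inv, fun i => (e i).inv, fun i => by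
    change (U i).map (e i).inv ≫ (X.compIso i).hom = (Y.compIso i).hom ≫ b.inv
    rw [← cancel_epi ((U i).map (e i).hom), ← cancel_mono b.hom, ← Functor.map_comp_assoc,
      (e i).hom_inv_id, CategoryTheory.Functor.map_id, Category.id_comp, ← h]
    simp⟩
  hom_inv_id := Hom.ext b.hom_inv_id (funext fun i => (e i).hom_inv_id)
  inv_hom_id := Hom.ext b.inv_hom_id (funext fun i => (e i).inv_hom_id)

/-! ### Directed colimits in multiple pullbacks -/

section Colimits

variable {J : Type w} [SmallCategory J] [IsFiltered J] {D : J ⥤ MultiPullback U}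
  {b : Cocone (D ⋙ toSet U)}

/-- A component of a directed colimit in the multiple pullback: the colimit in `K i`, transported so
that its underlying set is the prescribed colimit of sets on the nose. -/
lemma exists_colimitCocone (hU : ∀ i, IsCoherentConcrete (U i)) (hU' : ∀ i, LiftsIsos (U i))
    (hb : IsColimit b) (i : I) :
    ∃ (c : Cocone (D ⋙ proj U i)) (_ : IsColimit c) (h : (U i).obj c.pt = b.pt),
      ∀ j, (U i).map (c.ι.app j) ≫ eqToHom h = ((D.obj j).compIso i).hom ≫ b.ι.app j := by
  have := (hU i).hasDirectedColimits.hasColimitsOfShape J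
  have := (hU i).preservesDirectedColimits.preservesColimitsOfShape J
  let γ : (D ⋙ proj U i) ⋙ U i ≅ D ⋙ toSet U :=
    NatIso.ofComponents (fun j => (D.obj j).compIso i) fun f => map_app_comp (D.map f) i
  have hc := colimit.isColimit (D ⋙ proj U i)
  obtain ⟨⟨B, p⟩, h, hp⟩ := hU' i
    ((isColimitOfPreserves (U i) hc).coconePointsIsoOfNatIso hb γ)
  refine ⟨(colimit.cocone _).extend p.hom, hc.extendIso p.hom, h, fun j => ?_⟩
  have h₁ := (isColimitOfPreserves (U i) hc).comp_coconePointsIsoOfNatIso_hom hb γ j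
  rw [← hp] at h₁
  refine Eq.trans ?_ h₁
  change (U i).map (_ ≫ p.hom) ≫ _ = _
  rw [Functor.map_comp, Category.assoc]
  rfl

variable {c : ∀ i, Cocone (D ⋙ proj U i)} (h : ∀ i, (U i).obj (c i).pt = b.pt)
  (hι : ∀ i j, (U i).map ((c i).ι.app j) ≫ eqToHom (h i) =
    ((D.obj j).compIso i).hom ≫ b.ι.app j)

/-- The cocone in the multiple pullback given by cocones on the components. -/
def cocone : Cocone D where
  pt := ⟨b.pt, fun i => (c i).pt, h⟩
  ι :=
    { app := fun j => ⟨b.ι.app j, fun i => (c i).ι.app j, fun i => hι i j⟩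
      naturality := fun _ _ f =>
        Hom.ext (b.ι.naturality f) (funext fun i => (c i).ι.naturality f) }

include hι in
lemma map_comp_compIso_of_isColimit (hU : ∀ i, IsCoherentConcrete (U i))
    (hc : ∀ i, IsColimit (c i)) {X : MultiPullback U} (f : ∀ j, D.obj j ⟶ X) (i : I)
    (d : b.pt ⟶ X.base) (d' : (c i).pt ⟶ X.obj i) (hd : ∀ j, b.ι.app j ≫ d = (f j).base)
    (hd' : ∀ j, (c i).ι.app j ≫ d' = (f j).app i) :
    (U i).map d' ≫ (X.compIso i).hom = eqToHom (h i) ≫ d := by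
  have := (hU i).preservesDirectedColimits.preservesColimitsOfShape J
  refine (isColimitOfPreserves (U i) (hc i)).hom_ext fun j => ?_
  have h₁ : (U i).map ((c i).ι.app j) ≫ (U i).map d' = (U i).map ((f j).app i) := by
    rw [← Functor.map_comp, hd']
    rfl
  have h₂ : (U i).map ((c i).ι.app j) ≫ (U i).map d' ≫ (X.compIso i).hom =
      ((D.obj j).compIso i).hom ≫ b.ι.app j ≫ d :=
    (Category.assoc _ _ _).symm.trans ((congrArg (· ≫ (X.compIso i).hom) h₁).trans
      ((map_app_comp (f j) i).trans (congrArg (((D.obj j).compIso i).hom ≫ ·) (hd j)).symm))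
  refine h₂.trans ?_
  have h₃ := congrArg (· ≫ d) (hι i j)
  exact ((Category.assoc _ _ _).symm.trans h₃.symm).trans (Category.assoc _ _ _)

/-- The cocone in the multiple pullback given by colimit cocones on the components is one. -/
def isColimitCocone (hU : ∀ i, IsCoherentConcrete (U i)) (hb : IsColimit b)
    (hc : ∀ i, IsColimit (c i)) : IsColimit (cocone h hι) where
  desc s := ⟨hb.desc ((toSet U).mapCocone s), fun i => (hc i).desc ((proj U i).mapCocone s),
    fun i => map_comp_compIso_of_isColimit h hι hU hc s.ι.app i _ _
      (fun j => hb.fac ((toSet U).mapCocone s) j)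
      fun j => (hc i).fac ((proj U i).mapCocone s) j⟩
  fac s j := Hom.ext (hb.fac _ j) (funext fun i => (hc i).fac ((proj U i).mapCocone s) j)
  uniq s _ hm := Hom.ext (hb.uniq ((toSet U).mapCocone s) _ fun j => congrArg Hom.base (hm j))
    (funext fun i => (hc i).uniq ((proj U i).mapCocone s) _ fun j =>
      congrArg (fun f => Hom.app f i) (hm j))

end Colimits

section

variable (hU : ∀ i, IsCoherentConcrete (U i)) (hU' : ∀ i, LiftsIsos (U i))

include hU hU'

lemma directedColimits (J : Type w) [SmallCategory J] [IsFiltered J] :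
    HasColimitsOfShape J (MultiPullback U) ∧ PreservesColimitsOfShape J (toSet U) ∧
      ∀ i, PreservesColimitsOfShape J (proj U i) := by
  have key : ∀ D : J ⥤ MultiPullback U, ∃ (s : Cocone D) (_ : IsColimit s),
      Nonempty (IsColimit ((toSet U).mapCocone s)) ∧
      ∀ i, Nonempty (IsColimit ((proj U i).mapCocone s)) := fun D => by
    have hb := colimit.isColimit (D ⋙ toSet U)
    choose c hc h hι using exists_colimitCocone hU hU' hb
    exact ⟨cocone h hι, isColimitCocone h hι hU hb hc, ⟨hb⟩, fun i => ⟨hc i⟩⟩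
  refine ⟨⟨fun D => ?_⟩, ⟨fun {D} => ?_⟩, fun i => ⟨fun {D} => ?_⟩⟩ <;>
    obtain ⟨s, hs, ⟨h₁⟩, h₂⟩ := key D
  · exact ⟨⟨⟨s, hs⟩⟩⟩
  · exact preservesColimit_of_preserves_colimit_cocone hs h₁
  · exact preservesColimit_of_preserves_colimit_cocone hs (h₂ i).some

lemma preservesDirectedColimits_proj (i : I) : PreservesDirectedColimits (proj U i) :=
  fun J _ _ _ => (directedColimits hU hU' J).2.2 i

lemma isCoherentConcrete [Nonempty I] : IsCoherentConcrete (toSet U) where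
  hasDirectedColimits J _ _ _ := (directedColimits hU hU' J).1
  faithful := ⟨fun h => hom_ext (fun i => (hU i).faithful) h⟩
  preservesDirectedColimits J _ _ _ := (directedColimits hU hU' J).2.1
  coherent A B C h g := fun (f : A.base ⟶ B.base) hf => by
    have hf' : f ≫ g.base = h.base := hf
    choose f' hf' using fun i => (hU i).coherent (h.app i) (g.app i)
      ((A.compIso i).hom ≫ f ≫ (B.compIso i).inv) (by
        have h₁ : (U i).map (g.app i) = (B.compIso i).hom ≫ g.base ≫ (C.compIso i).inv := by
          rw [← map_app_comp_assoc, Iso.hom_inv_id, Category.comp_id]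
        have h₂ : (U i).map (h.app i) = (A.compIso i).hom ≫ h.base ≫ (C.compIso i).inv := by
          rw [← map_app_comp_assoc, Iso.hom_inv_id, Category.comp_id]
        rw [h₁, h₂, ← hf']
        simp)
    refine ⟨⟨f, f', fun i => ?_⟩, rfl⟩
    change (U i).map (f' i) ≫ (B.compIso i).hom = (A.compIso i).hom ≫ f
    rw [hf']
    simp
  map_injective A B f := by
    let i : I := Classical.arbitrary I
    have := (mono_iff_injective _).2 ((hU i).map_injective (f.app i))
    have h : f.base = (A.compIso i).inv ≫ (U i).map (f.app i) ≫ (B.compIso i).hom := by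
      rw [map_app_comp, Iso.inv_hom_id_assoc]
    refine (mono_iff_injective f.base).1 ?_
    rw [h]
    infer_instance

omit hU in
/-- A subset which is strong in each component is strong. -/
lemma isStrong_of_forall {A : MultiPullback U} (Y : Set A.base)
    (hY : ∀ i, IsStrong (U i) ((A.compIso i).hom ⁻¹' Y))
    (hinj : ∀ i, ∀ ⦃B C : K i⦄ (f : B ⟶ C), Function.Injective ((U i).map f)) :
    IsStrong (toSet U) (A := A) Y := by
  choose B g hg using hY
  have hm : ∀ i x, (A.compIso i).hom ((U i).map (g i) x) ∈ Y := fun i x => by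
    change (U i).map (g i) x ∈ (A.compIso i).hom ⁻¹' Y
    rw [← hg]
    exact Set.mem_range_self x
  -- the component of the subobject, renamed so that its underlying set is `Y` itself
  let q : ∀ i, (U i).obj (B i) ≅ Y := fun i => (Equiv.ofBijective
    (fun x => (⟨_, hm i x⟩ : Y)) ⟨fun x y hxy => hinj i (g i)
      (((mono_iff_injective (A.compIso i).hom).1 inferInstance) (congrArg Subtype.val hxy)),
    fun y => by
      have hy : (A.compIso i).inv y.1 ∈ Set.range ((U i).map (g i)) := by
        rw [hg]
        change (A.compIso i).hom ((A.compIso i).inv y.1) ∈ Y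
        simp
      obtain ⟨x, hx⟩ := hy
      refine ⟨x, Subtype.ext ?_⟩
      change (A.compIso i).hom ((U i).map (g i) x) = y.1
      rw [hx]
      simp⟩).toIso
  have hq : ∀ i, (q i).hom ≫ (↾Subtype.val : (Y : Type w) ⟶ A.base) =
      (U i).map (g i) ≫ (A.compIso i).hom := fun i => rfl
  choose p h hp using fun i => hU' i (q i)
  refine ⟨⟨Y, fun i => (p i).1, h⟩, ⟨↾Subtype.val, fun i => (p i).2.inv ≫ g i, fun i => ?_⟩,
    Subtype.range_val⟩
  change (U i).map ((p i).2.inv ≫ g i) ≫ (A.compIso i).hom = eqToHom (h i) ≫ ↾Subtype.val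
  have h₁ : (U i).map (p i).2.hom ≫ eqToHom (h i) ≫ (↾Subtype.val : (Y : Type w) ⟶ A.base) =
      (U i).map (g i) ≫ (A.compIso i).hom := by
    rw [← hq, ← hp, Category.assoc]
  rw [← cancel_epi ((U i).map (p i).2.hom), ← Functor.map_comp_assoc, Iso.hom_inv_id_assoc]
  exact h₁.symm

lemma isLowenheimSkolem [Nonempty I] {κ : Cardinal.{w}} (hκ : κ.IsRegular)
    (hκ' : Cardinal.aleph0 < κ) (hI : HasCardinalLT I κ)
    (h : ∀ i, IsLowenheimSkolem (U i) κ) : IsLowenheimSkolem (toSet U) κ where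
  exists_isStrong A X hX := by
    have : Fact κ.IsRegular := ⟨hκ⟩
    have hs : ∀ i x, (A.compIso i).hom ((A.compIso i).inv x) = x := fun i x => by simp
    obtain ⟨Y, h₁, h₂, h₃, h₄⟩ := exists_chain_closing_off hκ' (T := A.base) hI
      (fun i _ Z => IsStrong (U i) ((A.compIso i).hom ⁻¹' Z))
      (fun i Y hY => by
        obtain ⟨Z, h₁, h₂, h₃⟩ := (h i).exists_isStrong (A.obj i) ((A.compIso i).inv '' Y)
          (hY.of_surjective _ Set.imageFactorization_surjective)
        refine ⟨(A.compIso i).hom '' Z, fun y hy => ⟨_, h₁ ⟨y, hy, rfl⟩, hs i y⟩,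
          h₂.of_surjective _ Set.imageFactorization_surjective, ?_⟩
        rwa [Set.preimage_image_eq _ ((mono_iff_injective (A.compIso i).hom).1 inferInstance)])
      X hX
    refine ⟨⋃ n, Y n, h₁.trans (Set.subset_iUnion _ 0), h₃,
      isStrong_of_forall hU' _ (fun i => ?_) fun i => (hU i).map_injective⟩
    have e : (A.compIso i).hom ⁻¹' (⋃ n, Y n) = ⋃ n, (A.compIso i).hom ⁻¹' Y n :=
      Set.preimage_iUnion
    refine (congrArg (IsStrong (U i)) e).mpr ?_
    refine (hU i).isStrong_iUnion_of_interleaved _ fun n => ?_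
    obtain ⟨Z, h₁, h₂, h₃⟩ := h₄ i n
    exact ⟨_, Set.preimage_mono h₁, Set.preimage_mono h₂, h₃⟩
  essentiallySmall := by
    have := fun i => (h i).essentiallySmall
    choose Q hQ _ hQ' using fun i =>
      ObjectProperty.EssentiallySmall.exists_small_le (cardinalLT (U i) κ)
    let i₀ : I := Classical.arbitrary I
    -- an object is determined by its components and by how their underlying sets are identified
    refine essentiallySmall_of_code _
      (T := Σ q : ∀ i, Subtype (Q i), ∀ i, ((U i).obj (q i).1 ⟶ (U i₀).obj (q i₀).1))
      (fun (A : MultiPullback U)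
        (t : Σ q : ∀ i, Subtype (Q i), ∀ i, ((U i).obj (q i).1 ⟶ (U i₀).obj (q i₀).1)) =>
        ∃ e : ∀ i, A.obj i ≅ (t.1 i).1, ∀ i, (A.compIso i).hom ≫ (A.compIso i₀).inv ≫
          (U i₀).map (e i₀).hom = (U i).map (e i).hom ≫ t.2 i) ?_ ?_
    · intro A hA
      have hA' : ∀ i, cardinalLT (U i) κ (A.obj i) := fun i =>
        (hasCardinalLT_iff_of_equiv (A.compIso i).toEquiv κ).2 hA
      choose q hq e using fun i => hQ' i _ (hA' i)
      refine ⟨⟨fun i => ⟨q i, hq i⟩, fun i => (U i).map (e i).some.inv ≫ (A.compIso i).hom ≫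
        (A.compIso i₀).inv ≫ (U i₀).map (e i₀).some.hom⟩, fun i => (e i).some, fun i => ?_⟩
      rw [← Functor.map_comp_assoc, Iso.hom_inv_id, CategoryTheory.Functor.map_id,
        Category.id_comp]
    · rintro A A' ⟨q, t⟩ ⟨e, he⟩ ⟨e', he'⟩
      dsimp only at e he e' he'
      refine ⟨mkIso ((A.compIso i₀).symm ≪≫ (U i₀).mapIso (e i₀ ≪≫ (e' i₀).symm) ≪≫
        A'.compIso i₀) (fun i => e i ≪≫ (e' i).symm) fun i => ?_⟩
      have h₁ : (A'.compIso i).hom = (U i).map (e' i).hom ≫ t i ≫ (U i₀).map (e' i₀).inv ≫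
          (A'.compIso i₀).hom := by
        rw [← reassoc_of% (he' i), ← Functor.map_comp_assoc, Iso.hom_inv_id,
          CategoryTheory.Functor.map_id, Category.id_comp, Iso.inv_hom_id, Category.comp_id]
      rw [h₁]
      simp only [Iso.trans_hom, Iso.symm_hom, Functor.mapIso_hom, Functor.map_comp, Category.assoc]
      rw [reassoc_of% (he i), ← Functor.map_comp_assoc (U i) (e' i).inv, Iso.inv_hom_id,
        CategoryTheory.Functor.map_id, Category.id_comp]

omit hU in
lemma liftsIsos : LiftsIsos (toSet U) := by
  intro A S f
  choose p h hp using fun i => hU' i (A.compIso i ≪≫ f)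
  exact ⟨⟨⟨S, fun i => (p i).1, h⟩, mkIso f (fun i => (p i).2) hp⟩, rfl, Category.comp_id f.hom⟩

end

lemma isAEC [Nonempty I] (hU : ∀ i, IsAEC (U i)) : IsAEC (toSet U) := by
  have hU₁ := fun i => (hU i).isCoherentConcrete
  have hU₂ := fun i => (hU i).liftsIsos
  have hM := isCoherentConcrete hU₁ hU₂
  choose κ₀ hκ₀ h using fun i => (hU₁ i).exists_isLowenheimSkolem
    (hU i).concreteDirectedColimits.accessible
  let μ : Cardinal.{w} := max (max (Cardinal.sum κ₀) (Cardinal.mk I)) Cardinal.aleph0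
  have hκ : (Order.succ μ).IsRegular := Cardinal.isRegular_succ (le_max_right _ _)
  have hlt : μ < Order.succ μ := Order.lt_succ μ
  refine hM.isAEC hκ (isLowenheimSkolem hU₁ hU₂ hκ ((le_max_right _ _).trans_lt hlt) ?_
    fun i => h i _ hκ ?_) (liftsIsos hU₂) fun {A B} e => ?_
  · rw [hasCardinalLT_iff_cardinal_mk_lt]
    exact ((le_max_right _ _).trans (le_max_left _ _)).trans_lt hlt
  · exact (((Cardinal.le_sum κ₀ i).trans (le_max_left _ _)).trans (le_max_left _ _)).trans_lt hlt
  · choose g hg using fun i =>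
      (hU i).exists_iso_of_concrete hM.hasConcreteMonos (proj U i) (proj_comp U i) e
    refine ⟨mkIso (embIso e) g fun i => ?_, rfl⟩
    have := hg i
    rw [eqToHom_app, eqToHom_app] at this
    exact this

/-! ### Functors to a multiple pullback -/

section Lift

variable {T : Type (w + 1)} [Category.{w} T]

/-- The functor to the multiple pullback given by a compatible family of functors. -/
def lift (W : T ⥤ Type w) (H : ∀ i, T ⥤ K i) (h : ∀ i, H i ⋙ U i = W) : T ⥤ MultiPullback U where
  obj t := ⟨W.obj t, fun i => (H i).obj t, fun i => Functor.congr_obj (h i) t⟩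
  map f := ⟨W.map f, fun i => (H i).map f, fun i => by
    have := Functor.congr_hom (h i) f
    dsimp at this
    rw [this]
    simp⟩
  map_id t := Hom.ext (W.map_id t) (funext fun i => (H i).map_id t)
  map_comp f g := Hom.ext (W.map_comp f g) (funext fun i => (H i).map_comp f g)

/-- Functors to the multiple pullback agree if their components and their underlying set-valued
functors do. -/
lemma functor_ext {H H' : T ⥤ MultiPullback U} (h : H ⋙ toSet U = H' ⋙ toSet U)
    (h' : ∀ i, H ⋙ proj U i = H' ⋙ proj U i) : H = H' := by
  have key : ∀ {W W' : T ⥤ Type w} {G G' : ∀ i, T ⥤ K i} (hG : ∀ i, G i ⋙ U i = W)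
      (hG' : ∀ i, G' i ⋙ U i = W'), W = W' → G = G' → lift W G hG = lift W' G' hG' := by
    rintro W _ G _ hG hG' rfl rfl
    rfl
  have e : ∀ H : T ⥤ MultiPullback U, H = lift (H ⋙ toSet U) (fun i => H ⋙ proj U i)
    fun i => by rw [Functor.assoc, proj_comp] := fun H => rfl
  rw [e H, e H']
  exact key _ _ h (funext h')

lemma map_app_comp_of_liesOver {H H' : T ⥤ MultiPullback U} {W : T ⥤ Type w}
    (h : H ⋙ toSet U = W) (h' : H' ⋙ toSet U = W) (τ : W ⟶ W) {i : I}
    (e : (H ⋙ proj U i) ⋙ U i = W) (e' : W = (H' ⋙ proj U i) ⋙ U i)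
    {θ : H ⋙ proj U i ⟶ H' ⋙ proj U i}
    (hθ : Functor.whiskerRight θ (U i) = eqToHom e ≫ τ ≫ eqToHom e') (t : T) :
    (U i).map (θ.app t) ≫ ((H'.obj t).compIso i).hom =
      ((H.obj t).compIso i).hom ≫ (eqToHom h ≫ τ ≫ eqToHom h'.symm).app t := by
  have h₁ : (U i).map (θ.app t) = eqToHom (Functor.congr_obj e t) ≫ τ.app t ≫
      eqToHom (Functor.congr_obj e' t) := by
    have := congrArg (fun α => α.app t) hθ
    simp only [NatTrans.comp_app, eqToHom_app] at this
    exact this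
  have key : ∀ {x p q y z x' : Type w} (a : x = p) (f : p ⟶ q) (b : q = y) (c : y = z) (d : x = x')
      (a' : x' = p) (b' : q = z), (eqToHom a ≫ f ≫ eqToHom b) ≫ eqToHom c =
        eqToHom d ≫ eqToHom a' ≫ f ≫ eqToHom b' := by
    rintro x p q y z x' rfl f rfl rfl rfl - -
    simp
  rw [h₁, NatTrans.comp_app, NatTrans.comp_app, eqToHom_app, eqToHom_app]
  exact key _ _ _ ((H'.obj t).obj_eq i) ((H.obj t).obj_eq i) _ _

/-- Natural transformations to the multiple pullback are families of transformations over a common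
transformation of underlying sets. -/
def liftNatTrans {H H' : T ⥤ MultiPullback U} (τ : H ⋙ toSet U ⟶ H' ⋙ toSet U)
    (θ : ∀ i, H ⋙ proj U i ⟶ H' ⋙ proj U i)
    (h : ∀ i t, (U i).map ((θ i).app t) ≫ ((H'.obj t).compIso i).hom =
      ((H.obj t).compIso i).hom ≫ τ.app t) : H ⟶ H' where
  app t := ⟨τ.app t, fun i => (θ i).app t, fun i => h i t⟩
  naturality _ _ f := Hom.ext (τ.naturality f) (funext fun i => (θ i).naturality f)

end Lift

/-! ### Comparison with the multiple pseudopullback -/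

lemma toPseudo_isEquivalence (hU : ∀ i, LiftsIsos (U i)) : (toPseudo U).IsEquivalence where
  faithful := ⟨fun {X Y f g} h => Hom.ext (congrArg MultiPseudoPullback.Hom.base h)
    (congrArg MultiPseudoPullback.Hom.app h)⟩
  full := ⟨fun {X Y} f => ⟨⟨f.base, f.app, f.comm⟩, rfl⟩⟩
  essSurj := ⟨fun Y => by
    choose p h hp using fun i => hU i (Y.iso i)
    have hp' : ∀ i, (U i).map (p i).2.inv ≫ (Y.iso i).hom = eqToHom (h i) := fun i => by
      rw [← hp, ← Functor.map_comp_assoc, Iso.inv_hom_id, CategoryTheory.Functor.map_id,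
        Category.id_comp]
    exact ⟨⟨Y.base, fun i => (p i).1, h⟩, ⟨
      { hom := ⟨𝟙 _, fun i => (p i).2.inv, fun i => (hp' i).trans (Category.comp_id _).symm⟩
        inv := ⟨𝟙 _, fun i => (p i).2.hom, fun i => (hp i).trans (Category.comp_id _).symm⟩
        hom_inv_id := MultiPseudoPullback.Hom.ext (Category.comp_id _)
          (funext fun i => (p i).2.inv_hom_id)
        inv_hom_id := MultiPseudoPullback.Hom.ext (Category.comp_id _)
          (funext fun i => (p i).2.hom_inv_id) }⟩⟩⟩

end MultiPullback

/-! ### The universal properties in the two 2-categories -/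

namespace Acc

lemma whiskered_app {T I K L : Acc.{w}} {F G : K ⟶ L} {P : I ⟶ K} (φ : P ≫ F ⟶ P ≫ G)
    (H : T ⟶ I) (t : T.carrier) :
    (whiskered φ H).trans.app t = φ.trans.app ((Hom.functor H).obj t) := by
  change 𝟙 _ ≫ φ.trans.app ((Hom.functor H).obj t) ≫ 𝟙 _ = _
  rw [Category.id_comp, Category.comp_id]

lemma whiskered_eq_iff {T I K L : Acc.{w}} {F G : K ⟶ L} {P : I ⟶ K} (φ : P ≫ F ⟶ P ≫ G)
    (H : T ⟶ I) (ψ : (H ≫ P) ≫ F ⟶ (H ≫ P) ≫ G) :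
    whiskered φ H = eqToHom rfl ≫ ψ ≫ eqToHom rfl ↔
      ∀ t, φ.trans.app ((Hom.functor H).obj t) = ψ.trans.app t := by
  rw [eqToHom_refl, eqToHom_refl, Category.id_comp, Category.comp_id]
  refine ⟨fun h t => ?_, fun h => ?_⟩
  · rw [← whiskered_app, h]
  · ext t
    rw [whiskered_app, h]

lemma whiskered_comp_app {T I K L : Acc.{w}} {F G : K ⟶ L} {P : I ⟶ K}
    {φ : P ≫ F ⟶ P ≫ G} {H₁ H₂ : T ⟶ I} {θ : H₁ ≫ P ⟶ H₂ ≫ P}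
    (h : whiskered φ H₁ ≫ θ ▷ G = θ ▷ F ≫ whiskered φ H₂) (t : T.carrier) :
    φ.trans.app ((Hom.functor H₁).obj t) ≫ (Hom.functor G).map (θ.trans.app t) =
      (Hom.functor F).map (θ.trans.app t) ≫ φ.trans.app ((Hom.functor H₂).obj t) := by
  have := congrArg (fun α => (Hom₂.trans α).app t) h
  simp only [comp_trans, NatTrans.comp_app, whiskered_app] at this
  exact this

end Acc

namespace Acc3Star

lemma whiskered_app {T I K L : Acc3Star.{w}} {F G : K ⟶ L} {P : I ⟶ K} (φ : P ≫ F ⟶ P ≫ G)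
    (H : T ⟶ I) (t : T.carrier) :
    (whiskered φ H).trans.app t = φ.trans.app ((Hom.functor H).obj t) := by
  change 𝟙 _ ≫ φ.trans.app ((Hom.functor H).obj t) ≫ 𝟙 _ = _
  rw [Category.id_comp, Category.comp_id]

lemma whiskered_eq_iff {T I K L : Acc3Star.{w}} {F G : K ⟶ L} {P : I ⟶ K} (φ : P ≫ F ⟶ P ≫ G)
    (H : T ⟶ I) (ψ : (H ≫ P) ≫ F ⟶ (H ≫ P) ≫ G) :
    whiskered φ H = eqToHom rfl ≫ ψ ≫ eqToHom rfl ↔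
      ∀ t, φ.trans.app ((Hom.functor H).obj t) = ψ.trans.app t := by
  rw [eqToHom_refl, eqToHom_refl, Category.id_comp, Category.comp_id]
  refine ⟨fun h t => ?_, fun h => ?_⟩
  · rw [← whiskered_app, h]
  · ext t
    rw [whiskered_app, h]

lemma whiskered_comp_app {T I K L : Acc3Star.{w}} {F G : K ⟶ L} {P : I ⟶ K}
    {φ : P ≫ F ⟶ P ≫ G} {H₁ H₂ : T ⟶ I} {θ : H₁ ≫ P ⟶ H₂ ≫ P}
    (h : whiskered φ H₁ ≫ θ ▷ G = θ ▷ F ≫ whiskered φ H₂) (t : T.carrier) :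
    φ.trans.app ((Hom.functor H₁).obj t) ≫ (Hom.functor G).map (θ.trans.app t) =
      (Hom.functor F).map (θ.trans.app t) ≫ φ.trans.app ((Hom.functor H₂).obj t) := by
  have := congrArg (fun α => (Hom₂.trans α).app t) h
  simp only [comp_trans, NatTrans.comp_app, whiskered_app] at this
  exact this

lemma isCoherentConcrete (K : Acc3Star.{w}) : IsCoherentConcrete K.U := K.isAEC.isCoherentConcrete

/-- A functor to an abstract elementary class is accessible if it is so after forgetting to sets. -/
def accHomOfForget {T : Acc.{w}} {K : Acc3Star.{w}} (H : T.carrier ⥤ K.carrier)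
    (h : (H ⋙ K.U).IsAccessible.{w}) : T ⟶ K.toAcc :=
  Acc.Hom.mk H (K.isCoherentConcrete.isAccessible_of_comp H h)

/-- A concrete functor between abstract elementary classes preserves directed colimits. -/
def homMk {T K : Acc3Star.{w}} (H : T.carrier ⥤ K.carrier) (h : H ⋙ K.U = T.U) : T ⟶ K :=
  Hom.mk H h (K.isCoherentConcrete.preservesDirectedColimits_of_comp H (by
    rw [h]
    exact T.isCoherentConcrete.preservesDirectedColimits))

section Inserter

variable {K L : Acc3Star.{w}} (F G : K ⟶ L)

/-- The inserter of two concrete functors, as an abstract elementary class. -/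
def ins : Acc3Star.{w} where
  carrier := Ins F.functor G.functor
  U := Ins.proj F.functor G.functor ⋙ K.U
  isAEC := Ins.isAEC (eqToIso F.concrete) (eqToIso G.concrete) K.isAEC L.isAEC
    F.preservesDirectedColimits

/-- The projection of the inserter. -/
def insProj : ins F G ⟶ K :=
  Hom.mk (Ins.proj F.functor G.functor) rfl
    (Ins.preservesDirectedColimits_proj K.isCoherentConcrete F.preservesDirectedColimits)

/-- The universal 2-cell of the inserter. -/
def insTrans : insProj F G ≫ F ⟶ insProj F G ≫ G :=
  Hom₂.mk (Ins.trans F.functor G.functor)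

lemma isInserter_ins : IsInserter F G (insProj F G) (insTrans F G) where
  existsUnique_lift {T} H ψ := by
    refine ⟨homMk (K := ins F G) (Ins.lift H.functor ψ.trans) H.concrete, ⟨rfl, ?_⟩, ?_⟩
    · exact (whiskered_eq_iff _ _ _).2 fun _ => rfl
    · rintro H' ⟨rfl, h⟩
      refine Hom.ext (Ins.eq_lift H'.functor ψ.trans ((whiskered_eq_iff _ _ _).1 h))
  existsUnique_lift₂ {T} H₁ H₂ θ h := by
    have hc : ∀ t, (H₁.functor.obj t).str ≫ G.functor.map (θ.trans.app t) =
        F.functor.map (θ.trans.app t) ≫ (H₂.functor.obj t).str :=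
      whiskered_comp_app h
    refine ⟨Hom₂.mk
      { app := fun t => ⟨θ.trans.app t, hc t⟩
        naturality := fun _ _ f => Ins.hom_ext (θ.trans.naturality f) }, rfl, ?_⟩
    rintro θ' rfl
    rfl

lemma isInserter_toAcc_ins : IsInserter (Hom.toAcc F) (Hom.toAcc G) (Hom.toAcc (insProj F G))
    (Hom₂.toAcc (insTrans F G)) where
  existsUnique_lift {T} H ψ := by
    have hH : (H.functor ⋙ K.U).IsAccessible.{w} := by
      have := H.accessible
      have := K.forget.accessible
      exact inferInstanceAs (H.functor ⋙ K.forget.functor).IsAccessible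
    refine ⟨accHomOfForget (K := ins F G) (Ins.lift H.functor ψ.trans) hH, ⟨rfl, ?_⟩, ?_⟩
    · exact (Acc.whiskered_eq_iff _ _ _).2 fun _ => rfl
    · rintro H' ⟨rfl, h⟩
      refine Acc.Hom.ext (Ins.eq_lift H'.functor ψ.trans ((Acc.whiskered_eq_iff _ _ _).1 h))
  existsUnique_lift₂ {T} H₁ H₂ θ h := by
    have hc : ∀ t, (H₁.functor.obj t).str ≫ G.functor.map (θ.trans.app t) =
        F.functor.map (θ.trans.app t) ≫ (H₂.functor.obj t).str :=
      Acc.whiskered_comp_app h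
    refine ⟨Acc.Hom₂.mk
      { app := fun t => ⟨θ.trans.app t, hc t⟩
        naturality := fun _ _ f => Ins.hom_ext (θ.trans.naturality f) }, rfl, ?_⟩
    rintro θ' rfl
    rfl

end Inserter

section Equifier

variable {K L : Acc3Star.{w}} {F G : K ⟶ L} (φ ψ : F ⟶ G)

/-- The equifier of two transformations, as an abstract elementary class. -/
def equif : Acc3Star.{w} where
  carrier := Equif φ.trans ψ.trans
  U := Equif.proj φ.trans ψ.trans ⋙ K.U
  isAEC := (Equif.isAEC K.isAEC L.isAEC F.preservesDirectedColimits φ.trans ψ.trans).2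

/-- The inclusion of the equifier. -/
def equifProj : equif φ ψ ⟶ K :=
  Hom.mk (Equif.proj φ.trans ψ.trans) rfl
    (Equif.isAEC K.isAEC L.isAEC F.preservesDirectedColimits φ.trans ψ.trans).1

lemma isEquifier_equif : IsEquifier φ ψ (equifProj φ ψ) where
  whisker_eq := by
    ext t
    exact t.property
  existsUnique_lift {T} H h := by
    have h' : ∀ t, φ.trans.app (H.functor.obj t) = ψ.trans.app (H.functor.obj t) := fun t =>
      congrArg (fun α => (Hom₂.trans α).app t) h
    refine ⟨homMk (K := equif φ ψ) (ObjectProperty.lift _ H.functor h') H.concrete, rfl, ?_⟩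
    rintro H' rfl
    rfl
  existsUnique_lift₂ {T} H₁ H₂ θ := by
    refine ⟨Hom₂.mk
      { app := fun t => ObjectProperty.homMk (θ.trans.app t)
        naturality := fun _ _ f => ObjectProperty.hom_ext _ (θ.trans.naturality f) }, rfl, ?_⟩
    rintro θ' rfl
    rfl

lemma isEquifier_toAcc_equif :
    IsEquifier (Hom₂.toAcc φ) (Hom₂.toAcc ψ) (Hom.toAcc (equifProj φ ψ)) where
  whisker_eq := by
    ext t
    exact t.property
  existsUnique_lift {T} H h := by
    have h' : ∀ t, φ.trans.app (H.functor.obj t) = ψ.trans.app (H.functor.obj t) := fun t =>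
      congrArg (fun α => (Acc.Hom₂.trans α).app t) h
    have hH : (H.functor ⋙ K.U).IsAccessible.{w} := by
      have := H.accessible
      have := K.forget.accessible
      exact inferInstanceAs (H.functor ⋙ K.forget.functor).IsAccessible
    refine ⟨accHomOfForget (K := equif φ ψ) (ObjectProperty.lift _ H.functor h') hH, rfl, ?_⟩
    rintro H' rfl
    rfl
  existsUnique_lift₂ {T} H₁ H₂ θ := by
    refine ⟨Acc.Hom₂.mk
      { app := fun t => ObjectProperty.homMk (θ.trans.app t)
        naturality := fun _ _ f => ObjectProperty.hom_ext _ (θ.trans.naturality f) }, rfl, ?_⟩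
    rintro θ' rfl
    rfl

end Equifier

section Product

variable {J : Type w} [Nonempty J] (K : J → Acc3Star.{w})

/-- The multiple pullback over sets of a family, as an abstract elementary class. -/
def multiPullback : Acc3Star.{w} where
  carrier := MultiPullback fun j => (K j).U
  U := MultiPullback.toSet fun j => (K j).U
  isAEC := MultiPullback.isAEC fun j => (K j).isAEC

/-- The projections of the multiple pullback. -/
def multiPullbackProj (j : J) : multiPullback K ⟶ K j :=
  Hom.mk (MultiPullback.proj (fun j => (K j).U) j) (MultiPullback.proj_comp (fun j => (K j).U) j)
    (MultiPullback.preservesDirectedColimits_proj (fun j => (K j).isCoherentConcrete)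
      (fun j => (K j).isAEC.liftsIsos) j)

/-- The multiple pullback over sets is a product of abstract elementary classes. -/
def isLimitMultiPullback : IsLimit (Fan.mk (multiPullback K) (multiPullbackProj K)) :=
  Fan.IsLimit.mk _
    (fun s => homMk (K := multiPullback K) (MultiPullback.lift s.pt.U
      (fun j => Hom.functor (s.proj j)) fun j => Hom.concrete (s.proj j)) rfl)
    (fun _ _ => rfl)
    fun _ m hm => Hom.ext (MultiPullback.functor_ext (Hom.concrete m)
      fun j => congrArg Hom.functor (hm j))

/-- The multiple pullback over sets is a multiple pullback of accessible categories. -/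
def isLimitToAccMultiPullback :
    IsLimit (WidePullbackCone.mk (f := fun j => (K j).forget) (multiPullback K).forget
      (fun j => Hom.toAcc (multiPullbackProj K j))
      fun j => Hom.toAcc_comp_forget (multiPullbackProj K j)) :=
  WidePullbackCone.IsLimit.mk _
    (fun s => accHomOfForget (K := multiPullback K)
      (MultiPullback.lift (Acc.Hom.functor s.base) (fun j => Acc.Hom.functor (s.π j))
        fun j => congrArg Acc.Hom.functor (s.condition j)) (Acc.Hom.accessible s.base))
    (fun _ => rfl) (fun _ _ => rfl)
    fun _ _ hb hm => Acc.Hom.ext (MultiPullback.functor_ext (congrArg Acc.Hom.functor hb)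
      fun j => congrArg Acc.Hom.functor (hm j))

lemma existsUnique_multiPullback_hom₂ {T : Acc3Star.{w}} (H₁ H₂ : T ⟶ multiPullback K)
    (τ : T.U ⟶ T.U) (θ : ∀ j, H₁ ≫ multiPullbackProj K j ⟶ H₂ ≫ multiPullbackProj K j)
    (h : ∀ j, LiesOver (θ j) τ) : ∃! θ' : H₁ ⟶ H₂, ∀ j, θ' ▷ multiPullbackProj K j = θ j := by
  refine ⟨Hom₂.mk (MultiPullback.liftNatTrans
    (eqToHom (Hom.concrete H₁) ≫ τ ≫ eqToHom (Hom.concrete H₂).symm)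
    (fun j => (θ j).trans) fun j t => MultiPullback.map_app_comp_of_liesOver (Hom.concrete H₁)
      (Hom.concrete H₂) τ _ _ (h j) t), fun j => rfl, fun θ' h' => ?_⟩
  ext t
  exact MultiPullback.hom_ext_app fun j => congrArg (fun α => (Hom₂.trans α).app t) (h' j)

end Product

/-- The class of sets and injections, which is terminal. -/
def injSet : Acc3Star.{w} := ⟨InjSet.{w}, InjSet.U, InjSet.isAEC⟩

lemma hasLimitsOfShape_discrete (I : Type w) : HasLimitsOfShape (Discrete I) Acc3Star.{w} := by
  cases isEmpty_or_nonempty I with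
  | inl h =>
    have (T : Acc3Star.{w}) : Unique (T ⟶ injSet) :=
      { default := homMk (InjSet.lift T.isCoherentConcrete) rfl
        uniq := fun H => Hom.ext (InjSet.eq_lift T.isCoherentConcrete H.functor H.concrete) }
    have := hasTerminal_of_unique injSet.{w}
    exact hasLimitsOfShape_of_equivalence
      (Discrete.equivalence (Equiv.equivOfIsEmpty (PEmpty.{1}) I))
  | inr h =>
    refine ⟨fun D => ?_⟩
    have : HasLimit (Discrete.functor (D.obj ∘ Discrete.mk)) :=
      ⟨⟨⟨_, isLimitMultiPullback fun i => D.obj ⟨i⟩⟩⟩⟩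
    exact hasLimit_of_iso Discrete.natIsoFunctor.symm

lemma hasPIELimits : HasPIELimits.{w} Acc3Star.{w} where
  hasProducts := hasLimitsOfShape_discrete
  hasInserters F G := ⟨_, _, _, isInserter_ins F G⟩
  hasEquifiers φ ψ := ⟨_, _, isEquifier_equif φ ψ⟩

end Acc3Star

end AECLimits

theorem theorem3p3 :
    -- the 2-category has PIE-limits
    HasPIELimits.{w} Acc3Star.{w} ∧
    -- it is closed under inserters among accessible categories
    (∀ {K L : Acc3Star.{w}} (F G : K ⟶ L),
      ∃ (hU : IsAEC (Ins.proj F.functor G.functor ⋙ K.U))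
        (hP : PreservesDirectedColimits (Ins.proj F.functor G.functor)),
        let I : Acc3Star.{w} := ⟨Ins F.functor G.functor, Ins.proj F.functor G.functor ⋙ K.U, hU⟩
        let P : I ⟶ K := Acc3Star.Hom.mk (Ins.proj F.functor G.functor) rfl hP
        let φ : P ≫ F ⟶ P ≫ G := Acc3Star.Hom₂.mk (Ins.trans F.functor G.functor)
        IsInserter F G P φ ∧
        IsInserter (Acc3Star.Hom.toAcc F) (Acc3Star.Hom.toAcc G) (Acc3Star.Hom.toAcc P)
          (Acc3Star.Hom₂.toAcc φ)) ∧
    -- it is closed under equifiers among accessible categories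
    (∀ {K L : Acc3Star.{w}} {F G : K ⟶ L} (φ ψ : F ⟶ G),
      ∃ (hU : IsAEC (Equif.proj φ.trans ψ.trans ⋙ K.U))
        (hP : PreservesDirectedColimits (Equif.proj φ.trans ψ.trans)),
        let E : Acc3Star.{w} := ⟨Equif φ.trans ψ.trans, Equif.proj φ.trans ψ.trans ⋙ K.U, hU⟩
        let P : E ⟶ K := Acc3Star.Hom.mk (Equif.proj φ.trans ψ.trans) rfl hP
        IsEquifier φ ψ P ∧
        IsEquifier (Acc3Star.Hom₂.toAcc φ) (Acc3Star.Hom₂.toAcc ψ) (Acc3Star.Hom.toAcc P)) ∧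
    -- products are computed as multiple pullbacks over the category of sets
    (∀ (J : Type w) [Nonempty J] (K : J → Acc3Star.{w}),
      ∃ (hU : IsAEC (MultiPullback.toSet fun j => (K j).U))
        (hP : ∀ j, PreservesDirectedColimits (MultiPullback.proj (fun j => (K j).U) j)),
        let P : Acc3Star.{w} :=
          ⟨MultiPullback fun j => (K j).U, MultiPullback.toSet fun j => (K j).U, hU⟩
        let π : ∀ j, P ⟶ K j := fun j =>
          Acc3Star.Hom.mk (MultiPullback.proj (fun j => (K j).U) j)
            (MultiPullback.proj_comp (fun j => (K j).U) j) (hP j)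
        Nonempty (IsLimit (Fan.mk P π)) ∧
        Nonempty (IsLimit (WidePullbackCone.mk (f := fun j => (K j).forget) P.forget
          (fun j => Acc3Star.Hom.toAcc (π j)) fun j => Acc3Star.Hom.toAcc_comp_forget (π j))) ∧
        ∀ {T : Acc3Star.{w}} (H₁ H₂ : T ⟶ P) (τ : T.U ⟶ T.U) (θ : ∀ j, H₁ ≫ π j ⟶ H₂ ≫ π j),
          (∀ j, Acc3Star.LiesOver (θ j) τ) → ∃! θ' : H₁ ⟶ H₂, ∀ j, θ' ▷ π j = θ j) ∧
    -- these multiple pullbacks agree with the multiple pseudopullbacks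
    (∀ (J : Type w) (K : J → Acc3Star.{w}),
      (MultiPullback.toPseudo fun j => (K j).U).IsEquivalence) ∧
    -- bijections lift along the underlying set functors, uniquely for classes of structures
    (∀ K : Acc3Star.{w}, LiftsIsos K.U ∧
      (Function.Injective (canonicalFunctor K.U K.isAEC.concreteMonos).obj →
        IsTransportable K.U)) :=
  ⟨Acc3Star.hasPIELimits,
    fun F G => ⟨(Acc3Star.ins F G).isAEC, (Acc3Star.insProj F G).preservesDirectedColimits,
      Acc3Star.isInserter_ins F G, Acc3Star.isInserter_toAcc_ins F G⟩,
    fun φ ψ => ⟨(Acc3Star.equif φ ψ).isAEC, (Acc3Star.equifProj φ ψ).preservesDirectedColimits,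
      Acc3Star.isEquifier_equif φ ψ, Acc3Star.isEquifier_toAcc_equif φ ψ⟩,
    fun _ _ K => ⟨(Acc3Star.multiPullback K).isAEC,
      fun j => (Acc3Star.multiPullbackProj K j).preservesDirectedColimits,
      ⟨Acc3Star.isLimitMultiPullback K⟩, ⟨Acc3Star.isLimitToAccMultiPullback K⟩,
      Acc3Star.existsUnique_multiPullback_hom₂ K⟩,
    fun _ K => MultiPullback.toPseudo_isEquivalence fun j => (K j).isAEC.liftsIsos,
    fun K => ⟨K.isAEC.liftsIsos, K.isAEC.isTransportable⟩⟩
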